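/- Let $d\ge 1$, $\Omega=[-1/2,1/2]^d$, and let $f:\mathbb R^d\to\mathbb C$ be measurable, vanishing outside $\Omega$, and hermitian, i.e. $f(-x)=\overline{f(x)}$ for all $x$. There is a family $(\nu_\gamma)_{\gamma>0}$ of (deterministic) probability measures on $\mathbb R$ with the following properties. (1) Let $\gamma>0$ and let $\delta_n>0$ satisfy $\delta_n\to 0$ and $n\delta_n^d\to\gamma$. For each $n$ let $X_1,\dots,X_n$ (depending on $n$) be independent random points, uniformly distributed on the cube $\delta_n^{-1}\Omega=[-\delta_n^{-1}/2,\delta_n^{-1}/2]^d$; all the points, for all $n$, are defined on one probability space, with an arbitrary joint law for different $n$. Let $\lambda_1(n),\dots,\lambda_n(n)$ be the eigenvalues, with multiplicity, of the hermitian matrix $(f(X_i-X_j))_{1\le i,j\le n}$, and $\nu_n=\frac1n\sum_{i=1}^n\delta_{\lambda_i(n)}$. Then, almost surely, $\nu_n$ converges weakly to $\nu_\gamma$ as $n\to\infty$. (2) The map $\gamma\mapsto\nu_\gamma$ is continuous on $(0,\infty)$ for the topology of weak convergence. (3) If moreover $f$ is bounded, then for every $\gamma>0$ and every integer $m\ge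 0$ the $m$-th moment of $\nu_\gamma$ is finite and $$\int t^m\,\nu_\gamma(dt)=f(0)^m+\sum_{p=2}^m\frac{\gamma^{p-1}}{p!}\sum_{\phi\in\Sigma_{m,p}}\int_{(\mathbb R^d)^{p-1}}\prod_{j=1}^m f\bigl(y_{\phi(j)}-y_{\phi(j+1)}\bigr)\,dy_2\cdots dy_p ,$$ where $\Sigma_{m,p}$ is the set of surjections $\{1,\dots,m\}\to\{1,\dots,p\}$, $\phi(m+1)=\phi(1)$, $y_1=0$, and all the integrals converge absolutely. -/

import Mathlib

open MeasureTheory ProbabilityTheory Filter Topology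

/-- The closed cube `[-r/2, r/2]^d` of side `r`, centred at the origin.  Euclidean space is modelled
by `Fin d → ℝ`; only its additive, Borel and Lebesgue structures are used. -/
def centredCube (d : ℕ) (r : ℝ) : Set (Fin d → ℝ) :=
  Set.Icc (fun _ => -r / 2) (fun _ => r / 2)

/-- `f` is hermitian: `f (-x)` is the complex conjugate of `f x`. -/
def IsHermitianFun {d : ℕ} (f : (Fin d → ℝ) → ℂ) : Prop :=
  ∀ x, f (-x) = star (f x)

/-- The Euclidean matrix `(f (xᵢ - xⱼ))ᵢⱼ` of the points `x₁, …, xₙ`. -/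
def euclideanMatrix {d n : ℕ} (f : (Fin d → ℝ) → ℂ) (x : Fin n → Fin d → ℝ) :
    Matrix (Fin n) (Fin n) ℂ :=
  Matrix.of fun i j => f (x i - x j)

theorem euclideanMatrix_isHermitian {d n : ℕ} {f : (Fin d → ℝ) → ℂ} (hf : IsHermitianFun f)
    (x : Fin n → Fin d → ℝ) : (euclideanMatrix f x).IsHermitian := by
  ext i j
  simp only [euclideanMatrix, Matrix.conjTranspose_apply, Matrix.of_apply]
  rw [← hf, neg_sub]

open scoped NNReal in
/-- The empirical eigenvalue distribution `(1/n) ∑ᵢ δ_{λᵢ}` of a hermitian `n × n` matrix, the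
eigenvalues being repeated according to multiplicity (the zero measure if `n = 0`). -/
noncomputable def empiricalSpectralMeasure {n : ℕ} {A : Matrix (Fin n) (Fin n) ℂ}
    (hA : A.IsHermitian) : FiniteMeasure ℝ :=
  ⟨(n : ℝ≥0)⁻¹ • ∑ i, Measure.dirac (hA.eigenvalues i), inferInstance⟩

/-- For `φ : {1, …, m} → {1, …, q + 1}`, the product `∏ⱼ f (y_{φ(j)} - y_{φ(j+1)})` along the cycle
`φ(1), …, φ(m), φ(m+1) = φ(1)`, where `y₁ = 0` and `y₂, …, y_{q+1}` are the entries of `y`. -/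
def cycleProduct {d m q : ℕ} (f : (Fin d → ℝ) → ℂ) (φ : Fin m → Fin (q + 1))
    (y : Fin q → Fin d → ℝ) : ℂ :=
  ∏ j : Fin m,
    f ((Fin.cons 0 y : Fin (q + 1) → Fin d → ℝ) (φ j) -
      (Fin.cons 0 y : Fin (q + 1) → Fin d → ℝ) (φ (finRotate m j)))

open Classical in
/-- `f(0)^m + ∑_{p=2}^m γ^{p-1}/p! ∑_φ ∫_{(ℝ^d)^{p-1}} ∏ⱼ f (y_{φ(j)} - y_{φ(j+1)}) dy₂ ⋯ dy_p`, the
inner sum being over all surjections `φ : {1, …, m} → {1, …, p}`.  The index `p` is written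
`q + 1`. -/
noncomputable def limitMoment {d : ℕ} (f : (Fin d → ℝ) → ℂ) (γ : ℝ) (m : ℕ) : ℂ :=
  f 0 ^ m + ∑ q ∈ Finset.Ico 1 m, ((γ : ℂ) ^ q / ((q + 1).factorial : ℂ)) *
    ∑ φ : Fin m → Fin (q + 1) with Function.Surjective φ,
      ∫ y : Fin q → Fin d → ℝ, cycleProduct f φ y

/-!
# Limits of spectral measures of Euclidean random matrices

For bounded `f` the method of moments applies. The expected normalised trace of the `k`-th power of
the matrix is a sum over closed walks on the points, grouped by the surjection that records which
steps visit the same point. A surjection onto `q + 1` points contributes about `n ^ (q + 1) / (q + 1)!`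
walks (the labels of the points being arbitrary), and placing the first point anywhere in the cube leaves an integral over the other `q` points
relative to it, with density `δ ^ d` for each. As `n δ ^ d → γ`, the mean moments tend to `limitMoment`
(`tendsto_meanMoment`). A walk through `p` points has expectation at most `C ^ k (δ ^ d) ^ (p - 1)`, so the
`k`-th mean moment is at most `C ^ k ∑ p ^ k G ^ (p - 1) / p!` for `G ≥ n δ ^ d`
(`norm_meanMoment_le`). These bounds have a finite exponential generating function everywhere, so the
characteristic functions of the mean spectral measures are the exponential series of the moments, and
dominated convergence gives their limit. Lévy's theorem then produces the limit law, together with its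
continuity in `γ` and its moments (`exists_charFun_eq_limitCharFun`).

For unbounded `f`, cut off the values of size above `‖f 0‖ + k`. This changes only the rows of points
that have another point in a relative position where `f` is that large, on average at most
`n δ ^ d` times the volume of the exceptional set per point. Perturbing `s` rows and columns of a
hermitian matrix moves each eigenvalue count by at most `s` (`card_eigenvalues_gt_le`). Tested against
a ramp of height `b - a`, the spectral measures of `f` and of its truncation therefore differ in mean by
`(b - a) γ` times the volume of the exceptional set in the limit, which tends to zero with `k`. Ramps
determine weak convergence, tightness included (`exists_tendsto_of_cauchy_ramp`,
`tendsto_of_tendsto_ramp`), so the limit laws of the truncations converge, locally uniformly in `γ`, and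
their limit is the limit of the mean spectral measures of `f` (`exists_limitLaw`).

Finally, moving one point perturbs one row and column, so the integral of a ramp against the empirical
measure has differences bounded by `(b - a) / n`. McDiarmid's inequality gives deviation probabilities
that are summable in `n`, and the Borel–Cantelli lemma yields almost sure convergence whatever the joint
law for different `n` (`ae_tendsto_sub_mean_of_bounded_differences`).
-/

/-! ### Ramp functions and weak convergence on the line -/

/-- The ramp `x ↦ ∫_a^b 1_{t < x} dt`, which is `0` left of `a`, has slope one on `[a, b]` and is
constant right of `b`. -/
def ramp (a b x : ℝ) : ℝ := max a (min x b) - a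

lemma continuous_ramp (a b : ℝ) : Continuous (ramp a b) := by
  unfold ramp; fun_prop

lemma ramp_nonneg (a b x : ℝ) : 0 ≤ ramp a b x := by
  simp [ramp]

lemma ramp_le {a b : ℝ} (hab : a ≤ b) (x : ℝ) : ramp a b x ≤ b - a := by
  simp [ramp, hab]

lemma ramp_of_le {a b x : ℝ} (hx : x ≤ a) : ramp a b x = 0 := by
  simp [ramp, hx]

lemma ramp_of_ge {a b x : ℝ} (hab : a ≤ b) (hx : b ≤ x) : ramp a b x = b - a := by
  simp [ramp, hx, hab]

/-- The ramp as a bounded continuous function. -/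
noncomputable def rampBCF (a b : ℝ) (hab : a ≤ b) : BoundedContinuousFunction ℝ ℝ :=
  BoundedContinuousFunction.ofNormedAddCommGroup (ramp a b) (continuous_ramp a b) (b - a)
    fun x => by rw [Real.norm_of_nonneg (ramp_nonneg a b x)]; exact ramp_le hab x

lemma integrable_ramp {a b : ℝ} (hab : a ≤ b) (μ : Measure ℝ) [IsFiniteMeasure μ] :
    Integrable (ramp a b) μ :=
  (rampBCF a b hab).integrable μ

lemma continuous_integral_ramp {a b : ℝ} (hab : a ≤ b) :
    Continuous fun μ : ProbabilityMeasure ℝ => ∫ x, ramp a b x ∂(μ : Measure ℝ) :=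
  continuous_iff_continuousAt.2 fun _ =>
    ProbabilityMeasure.tendsto_iff_forall_integral_tendsto.1 tendsto_id (rampBCF a b hab)

/-- Steep ramps approximate the indicator of a half-line. -/
lemma tendsto_integral_ramp_Ioi (μ : Measure ℝ) [IsProbabilityMeasure μ] (q : ℚ) :
    Tendsto (fun k : ℕ => ((k : ℝ) + 1) * ∫ x, ramp (q : ℝ) ((q + 1 / ((k : ℚ) + 1) : ℚ) : ℝ) x ∂μ)
      atTop (𝓝 (μ.real (Set.Ioi (q : ℝ)))) := by
  have hpos : ∀ k : ℕ, (0 : ℝ) < (k : ℝ) + 1 := fun k => by positivity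
  have hle : ∀ k : ℕ, (q : ℝ) ≤ ((q + 1 / ((k : ℚ) + 1) : ℚ) : ℝ) := fun k => by
    push_cast; have := hpos k; simp; positivity
  rw [← integral_indicator_one measurableSet_Ioi]
  simp_rw [← integral_const_mul]
  refine tendsto_integral_of_dominated_convergence (fun _ => 1) (fun k => ?_)
    (integrable_const _) (fun k => ae_of_all _ fun x => ?_) (ae_of_all _ fun x => ?_)
  · exact ((continuous_ramp _ _).const_mul _).aestronglyMeasurable
  · have h1 := ramp_le (hle k) x
    have h2 := hpos k
    rw [Real.norm_of_nonneg (mul_nonneg h2.le (ramp_nonneg _ _ _))]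
    calc ((k : ℝ) + 1) * ramp _ _ x ≤ ((k : ℝ) + 1) * (1 / ((k : ℝ) + 1)) := by
          gcongr
          refine h1.trans ?_
          push_cast; simp
      _ = 1 := by field_simp
  · by_cases hx : x ≤ q
    · simp [ramp_of_le hx, hx]
    · push Not at hx
      have h0 : Tendsto (fun k : ℕ => (q : ℝ) + 1 / ((k : ℝ) + 1)) atTop (𝓝 ((q : ℝ) + 0)) :=
        tendsto_const_nhds.add tendsto_one_div_add_atTop_nhds_zero_nat
      rw [add_zero] at h0
      refine Tendsto.congr' ?_ tendsto_const_nhds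
      filter_upwards [h0.eventually (gt_mem_nhds hx)] with k hk
      rw [ramp_of_ge (hle k) (by push_cast; exact hk.le)]
      have := hpos k
      simp only [Set.indicator, Set.mem_Ioi, hx, if_true, Pi.one_apply]
      push_cast
      field_simp
      ring

/-- A probability measure on the line is determined by its integrals against ramps with rational
endpoints. -/
theorem ext_of_integral_ramp {μ ν : Measure ℝ} [IsProbabilityMeasure μ] [IsProbabilityMeasure ν]
    (h : ∀ a b : ℚ, a < b → ∫ x, ramp a b x ∂μ = ∫ x, ramp a b x ∂ν) : μ = ν := by
  refine ext_of_generate_finite (⋃ a : ℚ, {Set.Ioi (a : ℝ)})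
    (BorelSpace.measurable_eq.trans Real.borel_eq_generateFrom_Ioi_rat) Real.isPiSystem_Ioi_rat
    (fun s hs => ?_) (by simp)
  obtain ⟨q, rfl⟩ : ∃ q : ℚ, s = Set.Ioi (q : ℝ) := by simpa [eq_comm] using hs
  have h1 := tendsto_integral_ramp_Ioi μ q
  have h2 := tendsto_integral_ramp_Ioi ν q
  have : ∀ k : ℕ, ∫ x, ramp (q : ℝ) ((q + 1 / ((k : ℚ) + 1) : ℚ) : ℝ) x ∂μ =
      ∫ x, ramp (q : ℝ) ((q + 1 / ((k : ℚ) + 1) : ℚ) : ℝ) x ∂ν := fun k =>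
    h _ _ (by have : (0 : ℚ) < 1 / ((k : ℚ) + 1) := by positivity
              linarith)
  simp_rw [this] at h1
  exact (measureReal_eq_measureReal_iff).1 (tendsto_nhds_unique h1 h2)

lemma tendsto_integral_ramp_atTop (μ : Measure ℝ) [IsProbabilityMeasure μ] :
    Tendsto (fun M : ℕ => ∫ x, ramp M (M + 1) x ∂μ) atTop (𝓝 0) := by
  rw [← integral_zero ℝ ℝ (μ := μ)]
  refine tendsto_integral_of_dominated_convergence (fun _ => 1) (fun k => ?_)
    (integrable_const _) (fun k => ae_of_all _ fun x => ?_) (ae_of_all _ fun x => ?_)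
  · exact (continuous_ramp _ _).aestronglyMeasurable
  · rw [Real.norm_of_nonneg (ramp_nonneg _ _ _)]
    simpa using ramp_le (by linarith : (k : ℝ) ≤ k + 1) x
  · refine Tendsto.congr' ?_ tendsto_const_nhds
    filter_upwards [eventually_ge_atTop ⌈x⌉₊] with M hM
    exact (ramp_of_le (Nat.ceil_le.1 hM)).symm

lemma tendsto_integral_ramp_atBot (μ : Measure ℝ) [IsProbabilityMeasure μ] :
    Tendsto (fun M : ℕ => ∫ x, ramp (-(M + 1)) (-M) x ∂μ) atTop (𝓝 1) := by
  have h1 : ∫ _x : ℝ, (1 : ℝ) ∂μ = 1 := by simp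
  conv => rhs; rw [← h1]
  refine tendsto_integral_of_dominated_convergence (fun _ => 1) (fun k => ?_)
    (integrable_const _) (fun k => ae_of_all _ fun x => ?_) (ae_of_all _ fun x => ?_)
  · exact (continuous_ramp _ _).aestronglyMeasurable
  · rw [Real.norm_of_nonneg (ramp_nonneg _ _ _)]
    have := ramp_le (by linarith : -((k : ℝ) + 1) ≤ -k) x
    linarith
  · refine Tendsto.congr' ?_ tendsto_const_nhds
    filter_upwards [eventually_ge_atTop ⌈-x⌉₊] with M hM
    have := Nat.ceil_le.1 hM
    rw [ramp_of_ge (by linarith) (by linarith)]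
    ring

/-- A sequence of probability measures whose integrals against far-out ramps are eventually close to
`0` (on the right) and to `1` (on the left) is tight. -/
lemma isTightMeasureSet_of_ramp {μ : ℕ → ProbabilityMeasure ℝ}
    (h : ∀ ε : ℝ, 0 < ε → ∃ M : ℕ, ∀ᶠ n in atTop,
      ∫ x, ramp M (M + 1) x ∂(μ n : Measure ℝ) ≤ ε ∧
        1 - ε ≤ ∫ x, ramp (-(M + 1)) (-M) x ∂(μ n : Measure ℝ)) :
    IsTightMeasureSet (Set.range fun n => (μ n : Measure ℝ)) := by
  refine isTightMeasureSet_range_of_tendsto_limsup_measure_norm_gt ?_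
  rw [ENNReal.tendsto_nhds_zero]
  intro ε hε
  obtain ⟨e, he, hee⟩ : ∃ e : ℝ, 0 < e ∧ ENNReal.ofReal (2 * e) ≤ ε := by
    by_cases hε' : ε = ⊤
    · exact ⟨1, one_pos, by simp [hε']⟩
    · refine ⟨ε.toReal / 2, half_pos (ENNReal.toReal_pos hε.ne' hε'), ?_⟩
      rw [mul_div_cancel₀ _ two_ne_zero, ENNReal.ofReal_toReal hε']
  obtain ⟨M, hM⟩ := h e he
  filter_upwards [eventually_ge_atTop ((M : ℝ) + 1)] with r hr
  refine (limsup_le_of_le (h := ?_)).trans hee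
  filter_upwards [hM] with n hn
  have hi1 := integrable_ramp (by linarith : (M : ℝ) ≤ M + 1) (μ n : Measure ℝ)
  have hi2 := integrable_ramp (by linarith : -((M : ℝ) + 1) ≤ -M) (μ n : Measure ℝ)
  have hi3 : Integrable (fun x => ramp M (M + 1) x + (1 - ramp (-(M + 1)) (-M) x))
    (μ n : Measure ℝ) := hi1.add ((integrable_const _).sub hi2)
  have hmeas : MeasurableSet {x : ℝ | r < ‖x‖} := measurableSet_lt measurable_const measurable_norm
  have key : (μ n : Measure ℝ).real {x | r < ‖x‖} ≤ 2 * e := by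
    rw [← integral_indicator_one hmeas]
    calc ∫ x, Set.indicator {x : ℝ | r < ‖x‖} 1 x ∂(μ n : Measure ℝ)
        ≤ ∫ x, (ramp M (M + 1) x + (1 - ramp (-(M + 1)) (-M) x)) ∂(μ n : Measure ℝ) := by
          refine integral_mono ((integrable_const (1 : ℝ)).indicator hmeas) hi3 fun x => ?_
          have h1 := ramp_nonneg (M : ℝ) (M + 1) x
          have h2 := ramp_le (by linarith : -((M : ℝ) + 1) ≤ -M) x
          by_cases hx : r < ‖x‖
          · simp only [Set.indicator, Set.mem_ofPred_eq, hx, if_true, Pi.one_apply]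
            rw [Real.norm_eq_abs, lt_abs] at hx
            rcases hx with hx | hx
            · rw [ramp_of_ge (by linarith : (M : ℝ) ≤ M + 1) (by linarith)]
              linarith
            · rw [ramp_of_le (by linarith : x ≤ -((M : ℝ) + 1))]
              linarith
          · simp only [Set.indicator, Set.mem_ofPred_eq, hx, if_false]
            linarith
      _ ≤ 2 * e := by
          have hi4 : Integrable (fun x => 1 - ramp (-(M + 1)) (-M) x) (μ n : Measure ℝ) :=
            (integrable_const _).sub hi2
          rw [integral_add hi1 hi4, integral_sub (integrable_const _) hi2]
          simp only [integral_const, probReal_univ, smul_eq_mul, mul_one]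
          linarith [hn.1, hn.2]
  rw [← ENNReal.ofReal_toReal (measure_ne_top (μ n : Measure ℝ) {x | r < ‖x‖})]
  exact ENNReal.ofReal_le_ofReal key

/-- A sequence in a compact set converges once its images under enough continuous maps into Hausdorff
spaces converge, where "enough" means that the maps separate points. -/
lemma exists_tendsto_of_separating {X Y ι : Type*} [TopologicalSpace X] [TopologicalSpace Y] [T2Space Y]
    {K : Set X} (hK : IsCompact K) {u : ℕ → X} (hu : ∀ n, u n ∈ K) (G : ι → X → Y)
    (hG : ∀ i, Continuous (G i)) (hsep : ∀ x y, (∀ i, G i x = G i y) → x = y)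
    (r : ι → Y) (hr : ∀ i, Tendsto (fun n => G i (u n)) atTop (𝓝 (r i))) :
    ∃ x, Tendsto u atTop (𝓝 x) ∧ ∀ i, G i x = r i := by
  have key : ∀ y, MapClusterPt y atTop u → ∀ i, G i y = r i := fun y hy i => by
    have h1 : MapClusterPt (G i y) atTop (G i ∘ u) := hy.continuousAt_comp (hG i).continuousAt
    by_contra hne
    obtain ⟨U, V, hU, hV, hyU, hrV, hUV⟩ := t2_separation hne
    obtain ⟨n, hn1, hn2⟩ := ((mapClusterPt_iff_frequently.1 h1 U (hU.mem_nhds hyU)).and_eventually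
      ((hr i).eventually (hV.mem_nhds hrV))).exists
    exact Set.disjoint_left.1 hUV hn1 hn2
  obtain ⟨x, -, hx⟩ := hK.exists_mapClusterPt (f := atTop) (u := u)
    (tendsto_principal.2 (Eventually.of_forall hu))
  refine ⟨x, hK.tendsto_nhds_of_unique_mapClusterPt (Eventually.of_forall hu) fun y _ hy => ?_,
    key x hx⟩
  exact hsep _ _ fun i => (key y hy i).trans (key x hx i).symm

/-- A tight sequence of probability measures whose integrals against rational ramps all converge is
weakly convergent. -/
lemma exists_tendsto_of_tendsto_ramp {μ : ℕ → ProbabilityMeasure ℝ}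
    (ht : IsTightMeasureSet (Set.range fun n => (μ n : Measure ℝ))) (r : ℚ → ℚ → ℝ)
    (h : ∀ a b : ℚ, a < b →
      Tendsto (fun n => ∫ x, ramp a b x ∂(μ n : Measure ℝ)) atTop (𝓝 (r a b))) :
    ∃ ν : ProbabilityMeasure ℝ, Tendsto μ atTop (𝓝 ν) ∧
      ∀ a b : ℚ, a < b → ∫ x, ramp a b x ∂(ν : Measure ℝ) = r a b := by
  have hK : IsCompact (closure (Set.range μ)) := by
    refine isCompact_closure_of_isTightMeasureSet ?_
    convert ht using 1
    ext; simp
  obtain ⟨ν, h1, h2⟩ := exists_tendsto_of_separating (ι := {p : ℚ × ℚ // p.1 < p.2}) hK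
    (u := μ) (fun n => subset_closure ⟨n, rfl⟩)
    (fun p ν => ∫ x, ramp p.1.1 p.1.2 x ∂(ν : Measure ℝ))
    (fun p => continuous_integral_ramp (by exact_mod_cast p.2.le))
    (fun x y hxy => ProbabilityMeasure.toMeasure_injective (ext_of_integral_ramp fun a b hab => hxy ⟨(a, b), hab⟩))
    (fun p => r p.1.1 p.1.2) (fun p => h _ _ p.2)
  exact ⟨ν, h1, fun a b hab => h2 ⟨(a, b), hab⟩⟩

/-- Convergence of the integrals against rational ramps to those of a probability measure implies weak
convergence. -/
theorem tendsto_of_tendsto_ramp {μ : ℕ → ProbabilityMeasure ℝ} {ν : ProbabilityMeasure ℝ}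
    (h : ∀ a b : ℚ, a < b → Tendsto (fun n => ∫ x, ramp a b x ∂(μ n : Measure ℝ)) atTop
      (𝓝 (∫ x, ramp a b x ∂(ν : Measure ℝ)))) : Tendsto μ atTop (𝓝 ν) := by
  have ht : IsTightMeasureSet (Set.range fun n => (μ n : Measure ℝ)) := by
    refine isTightMeasureSet_of_ramp fun ε hε => ?_
    obtain ⟨M, h1, h2⟩ := (((tendsto_integral_ramp_atTop (ν : Measure ℝ)).eventually
      (gt_mem_nhds hε)).and ((tendsto_integral_ramp_atBot (ν : Measure ℝ)).eventually
      (lt_mem_nhds (by linarith : 1 - ε < 1)))).exists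
    refine ⟨M, ?_⟩
    have h3 := h M (M + 1) (by linarith)
    have h4 := h (-(M + 1)) (-M) (by linarith)
    push_cast at h3 h4
    filter_upwards [h3.eventually (gt_mem_nhds h1), h4.eventually (lt_mem_nhds h2)] with n h5 h6
    exact ⟨h5.le, h6.le⟩
  obtain ⟨ν', h1, h2⟩ := exists_tendsto_of_tendsto_ramp ht _ h
  rwa [← (ProbabilityMeasure.toMeasure_injective (ext_of_integral_ramp h2) : ν' = ν)]

/-- A sequence of probability measures that is Cauchy with respect to the integrals against
normalised ramps, uniformly over the ramps, converges weakly. -/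
theorem exists_tendsto_of_cauchy_ramp {μ : ℕ → ProbabilityMeasure ℝ} {ε : ℕ → ℝ}
    (hε : Tendsto ε atTop (𝓝 0))
    (h : ∀ (a b : ℝ), a < b → ∀ K L, K ≤ L →
      |∫ x, ramp a b x ∂(μ L : Measure ℝ) - ∫ x, ramp a b x ∂(μ K : Measure ℝ)| ≤ (b - a) * ε K) :
    ∃ ν : ProbabilityMeasure ℝ, Tendsto μ atTop (𝓝 ν) := by
  have ht : IsTightMeasureSet (Set.range fun n => (μ n : Measure ℝ)) := by
    refine isTightMeasureSet_of_ramp fun e he => ?_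
    obtain ⟨K, hK⟩ := (hε.eventually (gt_mem_nhds (half_pos he))).exists
    obtain ⟨M, h1, h2⟩ := (((tendsto_integral_ramp_atTop (μ K : Measure ℝ)).eventually
      (gt_mem_nhds (half_pos he))).and ((tendsto_integral_ramp_atBot (μ K : Measure ℝ)).eventually
      (lt_mem_nhds (by linarith : 1 - e / 2 < 1)))).exists
    refine ⟨M, ?_⟩
    filter_upwards [eventually_ge_atTop K] with L hL
    have h3 := abs_le.1 (h M (M + 1) (by linarith) K L hL)
    have h4 := abs_le.1 (h (-(M + 1)) (-M) (by linarith) K L hL)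
    constructor <;> nlinarith [h3.2, h4.1]
  have hc : ∀ a b : ℚ, a < b → ∃ r,
      Tendsto (fun n => ∫ x, ramp a b x ∂(μ n : Measure ℝ)) atTop (𝓝 r) := fun a b hab => by
    have hab' : (a : ℝ) < b := by exact_mod_cast hab
    refine cauchySeq_tendsto_of_complete (cauchySeq_of_le_tendsto_0' (fun K => (b - a) * ε K)
      (fun K L hKL => ?_) (by simpa using hε.const_mul ((b : ℝ) - a)))
    rw [dist_comm, Real.dist_eq]
    exact h a b hab' K L hKL
  choose! r hr using hc
  obtain ⟨ν, hν, -⟩ := exists_tendsto_of_tendsto_ramp ht r hr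
  exact ⟨ν, hν⟩

/-! ### Characteristic functions and moments of weak limits -/

/-- Lévy's theorem with the limit measure constructed: a pointwise limit of characteristic functions
which is continuous at the origin is a characteristic function. -/
theorem exists_charFun_eq_of_tendsto {μ : ℕ → ProbabilityMeasure ℝ} {Φ : ℝ → ℂ}
    (hΦ : ContinuousAt Φ 0)
    (h : ∀ t, Tendsto (fun n => charFun (μ n : Measure ℝ) t) atTop (𝓝 (Φ t))) :
    ∃ ν : ProbabilityMeasure ℝ, ∀ t, charFun (ν : Measure ℝ) t = Φ t := by
  have ht := isTightMeasureSet_of_tendsto_charFun (μ := fun n => (μ n : Measure ℝ)) hΦ h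
  have hK : IsCompact (closure (Set.range μ)) := by
    refine isCompact_closure_of_isTightMeasureSet ?_
    convert ht using 1
    ext; simp
  obtain ⟨ν, -, h2⟩ := exists_tendsto_of_separating hK
    (u := μ) (fun n => subset_closure ⟨n, rfl⟩)
    (fun t ν => charFun (ν : Measure ℝ) t)
    (fun t => continuous_iff_continuousAt.2 fun ν => by
      have := ProbabilityMeasure.tendsto_iff_forall_integral_rclike_tendsto ℂ |>.1
        (tendsto_id (x := 𝓝 ν)) (BoundedContinuousFunction.innerProbChar t)
      simp_rw [← charFun_eq_integral_innerProbChar] at this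
      exact this)
    (fun x y hxy => ProbabilityMeasure.toMeasure_injective (Measure.ext_of_charFun (funext hxy))) Φ h
  exact ⟨ν, h2⟩

/-- Method of moments, easy direction: if probability measures converge weakly and all their moments
converge, then the weak limit has all moments, and they are the limits of the moments. -/
theorem moments_of_tendsto {μ : ℕ → ProbabilityMeasure ℝ} {ν : ProbabilityMeasure ℝ}
    (hμ : Tendsto μ atTop (𝓝 ν)) {M : ℕ → ℝ}
    (hi : ∀ᶠ n in atTop, ∀ k : ℕ, Integrable (fun x : ℝ => x ^ k) (μ n : Measure ℝ))
    (hM : ∀ k : ℕ, Tendsto (fun n => ∫ x, x ^ k ∂(μ n : Measure ℝ)) atTop (𝓝 (M k))) (k : ℕ) :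
    Integrable (fun x : ℝ => x ^ k) (ν : Measure ℝ) ∧ ∫ x, x ^ k ∂(ν : Measure ℝ) = M k := by
  have hpos : ∀ (j : ℕ) (x : ℝ), 0 ≤ x ^ (2 * j) := fun j x => by
    rw [pow_mul]; exact pow_nonneg (sq_nonneg x) j
  have hν : ∀ j : ℕ, Integrable (fun x : ℝ => x ^ (2 * j)) (ν : Measure ℝ) := fun j => by
    have h1 := lintegral_le_liminf_lintegral_of_forall_isOpen_measure_le_liminf_measure
      (μ := (ν : Measure ℝ)) (μs := fun n => (μ n : Measure ℝ)) (f := fun x : ℝ => x ^ (2 * j))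
      (by fun_prop) (fun x => hpos j x)
      (fun G hG => ProbabilityMeasure.le_liminf_measure_open_of_tendsto hμ hG)
    have h2 : Tendsto (fun n => ∫⁻ x, ENNReal.ofReal (x ^ (2 * j)) ∂(μ n : Measure ℝ)) atTop
        (𝓝 (ENNReal.ofReal (M (2 * j)))) := by
      refine ((ENNReal.continuous_ofReal.tendsto _).comp (hM (2 * j))).congr' ?_
      filter_upwards [hi] with n hn
      exact ofReal_integral_eq_lintegral_ofReal (hn _)
        (ae_of_all _ (hpos j))
    rw [h2.liminf_eq] at h1
    refine ⟨by fun_prop, ?_⟩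
    rw [hasFiniteIntegral_iff_ofReal
      (ae_of_all _ (hpos j))]
    exact h1.trans_lt ENNReal.ofReal_lt_top
  have hνk : Integrable (fun x : ℝ => x ^ k) (ν : Measure ℝ) := by
    refine ((hν k).add (integrable_const (1 : ℝ))).mono' (by fun_prop) (ae_of_all _ fun x => ?_)
    have h1 := two_mul_le_add_sq |x ^ k| 1
    have h2 : |x ^ k| ^ 2 = x ^ (2 * k) := by rw [sq_abs, ← pow_mul, mul_comm]
    rw [h2] at h1
    simp only [Real.norm_eq_abs, Pi.add_apply]
    linarith [abs_nonneg (x ^ k)]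
  refine ⟨hνk, ?_⟩
  -- Cut `x ^ k` off at height `R`: the error is at most `x ^ (2 k) / R`.
  let c : ℝ → ℝ → ℝ := fun R x => max (-R) (min (x ^ k) R)
  have hcb : ∀ R, 0 < R → ∀ x, ‖c R x‖ ≤ R := fun R hR x => by
    rw [Real.norm_eq_abs, abs_le]
    exact ⟨le_max_left _ _, max_le (by linarith) (min_le_right _ _)⟩
  have hcc : ∀ R, Continuous (c R) := fun R => by fun_prop
  have hcd : ∀ R, 0 < R → ∀ x, ‖x ^ k - c R x‖ ≤ x ^ (2 * k) / R := fun R hR x => by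
    have h2 : x ^ (2 * k) = x ^ k * x ^ k := by rw [two_mul, pow_add]
    rw [h2, le_div_iff₀ hR, Real.norm_eq_abs]
    simp only [c]
    generalize x ^ k = y
    rcases le_total y (-R) with h | h
    · rw [min_eq_left (by linarith), max_eq_left h, abs_of_nonpos (by linarith)]
      nlinarith
    · rcases le_total y R with h' | h'
      · rw [min_eq_left h', max_eq_right h]; simp; nlinarith [mul_self_nonneg y]
      · rw [min_eq_right h', max_eq_right (by linarith), abs_of_nonneg (by linarith)]
        nlinarith
  have herr : ∀ (ρ : ProbabilityMeasure ℝ), Integrable (fun x : ℝ => x ^ k) (ρ : Measure ℝ) →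
      Integrable (fun x : ℝ => x ^ (2 * k)) (ρ : Measure ℝ) → ∀ R, 0 < R →
      |∫ x, x ^ k ∂(ρ : Measure ℝ) - ∫ x, c R x ∂(ρ : Measure ℝ)| ≤
        (∫ x, x ^ (2 * k) ∂(ρ : Measure ℝ)) / R := fun ρ h1 h2 R hR => by
    have h3 : Integrable (c R) (ρ : Measure ℝ) :=
      (integrable_const R).mono' (hcc R).aestronglyMeasurable (ae_of_all _ (hcb R hR))
    rw [← integral_sub h1 h3, ← integral_div]
    exact (norm_integral_le_integral_norm _).trans
      (integral_mono (h1.sub h3).norm (h2.div_const R) (hcd R hR))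
  have hbound : ∀ R, 0 < R → |∫ x, x ^ k ∂(ν : Measure ℝ) - M k| ≤
      (∫ x, x ^ (2 * k) ∂(ν : Measure ℝ) + M (2 * k)) / R := fun R hR => by
    have h1 := herr ν hνk (hν k) R hR
    have h2 : Tendsto (fun n => ∫ x, c R x ∂(μ n : Measure ℝ)) atTop
        (𝓝 (∫ x, c R x ∂(ν : Measure ℝ))) :=
      ProbabilityMeasure.tendsto_iff_forall_integral_tendsto.1 hμ
        (BoundedContinuousFunction.ofNormedAddCommGroup (c R) (hcc R) R (hcb R hR))
    have h3 := le_of_tendsto_of_tendsto ((hM k).sub h2).abs ((hM (2 * k)).div_const R)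
      (hi.mono fun n hn => herr (μ n) (hn _) (hn _) R hR)
    rw [add_div]
    rw [abs_le] at *
    constructor <;> linarith [h1.1, h1.2, h3.1, h3.2]
  have hlim : Tendsto (fun R : ℝ => (∫ x, x ^ (2 * k) ∂(ν : Measure ℝ) + M (2 * k)) / R) atTop
      (𝓝 0) := tendsto_const_nhds.div_atTop tendsto_id
  have h0 := ge_of_tendsto hlim ((eventually_gt_atTop 0).mono hbound)
  exact sub_eq_zero.1 (abs_nonpos_iff.1 h0)

/-! ### Eigenvalue counting under perturbations supported on few rows -/

section Spectral

variable {n : Type*} [Fintype n] [DecidableEq n]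

lemma inner_toEuclideanLin_eq_sum {A : Matrix n n ℂ} (hA : A.IsHermitian) (v : EuclideanSpace ℂ n) :
    inner ℂ v (Matrix.toEuclideanLin A v) =
      ∑ k, ((hA.eigenvalues k * ‖hA.eigenvectorBasis.repr v k‖ ^ 2 : ℝ) : ℂ) := by
  rw [← hA.eigenvectorBasis.sum_inner_mul_inner]
  refine Finset.sum_congr rfl fun k _ => ?_
  have hs : (Matrix.toEuclideanLin A).IsSymmetric := Matrix.isSymmetric_toEuclideanLin_iff.2 hA
  have he : Matrix.toEuclideanLin A (hA.eigenvectorBasis k) =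
      (hA.eigenvalues k : ℂ) • hA.eigenvectorBasis k := by
    ext i
    have := congrFun (hA.mulVec_eigenvectorBasis k) i
    simpa [Matrix.toLpLin_apply] using this
  rw [← hs, he, inner_smul_left, OrthonormalBasis.repr_apply_apply]
  rw [← inner_conj_symm v]
  simp only [Complex.conj_ofReal]
  push_cast
  rw [← Complex.conj_mul']
  ring

lemma inner_toEuclideanLin_congr {A B : Matrix n n ℂ} (S : Finset n)
    (h : ∀ i, i ∉ S → ∀ j, j ∉ S → A i j = B i j) (v : EuclideanSpace ℂ n) (hv : ∀ i ∈ S, v i = 0) :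
    inner ℂ v (Matrix.toEuclideanLin A v) = inner ℂ v (Matrix.toEuclideanLin B v) := by
  simp only [PiLp.inner_apply, Matrix.toLpLin_apply, Matrix.mulVec, dotProduct]
  refine Finset.sum_congr rfl fun i _ => ?_
  by_cases hi : i ∈ S
  · simp [hv i hi]
  · congr 1
    refine Finset.sum_congr rfl fun j _ => ?_
    by_cases hj : j ∈ S
    · simp [hv j hj]
    · rw [h i hi j hj]

/-- If two hermitian matrices agree outside the rows and columns indexed by `S`, their numbers of
eigenvalues above any level differ by at most `#S`.  Otherwise the span of the eigenvectors of `A`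
above the level would contain a nonzero vector that vanishes on `S` and is orthogonal to the
eigenvectors of `B` above the level, and the two quadratic forms would disagree on it. -/
theorem card_eigenvalues_gt_le {A B : Matrix n n ℂ} (hA : A.IsHermitian) (hB : B.IsHermitian)
    (S : Finset n) (h : ∀ i, i ∉ S → ∀ j, j ∉ S → A i j = B i j) (t : ℝ) :
    (Finset.univ.filter fun i => t < hA.eigenvalues i).card ≤
      (Finset.univ.filter fun i => t < hB.eigenvalues i).card + S.card := by
  by_contra! hlt
  let I := {i // t < hA.eigenvalues i}
  let J := {i // t < hB.eigenvalues i}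
  let E : (I → ℂ) →ₗ[ℂ] EuclideanSpace ℂ n :=
    (hA.eigenvectorBasis.repr.symm.toLinearEquiv.toLinearMap ∘ₗ
      (WithLp.linearEquiv 2 ℂ (n → ℂ)).symm.toLinearMap) ∘ₗ
      Function.ExtendByZero.linearMap ℂ (Subtype.val : I → n)
  let L : (I → ℂ) →ₗ[ℂ] (J → ℂ) × (S → ℂ) :=
    LinearMap.prod
      (LinearMap.pi fun k : J => (LinearMap.proj (k : n) ∘ₗ
        (WithLp.linearEquiv 2 ℂ (n → ℂ)).toLinearMap ∘ₗ
          hB.eigenvectorBasis.repr.toLinearEquiv.toLinearMap) ∘ₗ E)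
      (LinearMap.pi fun i : S => (LinearMap.proj (i : n) ∘ₗ
        (WithLp.linearEquiv 2 ℂ (n → ℂ)).toLinearMap) ∘ₗ E)
  have hker : LinearMap.ker L ≠ ⊥ := by
    refine LinearMap.ker_ne_bot_of_finrank_lt ?_
    rw [Module.finrank_prod, Module.finrank_fintype_fun_eq_card, Module.finrank_fintype_fun_eq_card,
      Module.finrank_fintype_fun_eq_card, Fintype.card_coe S, Fintype.card_subtype,
      Fintype.card_subtype]
    exact hlt
  obtain ⟨c, hc, hc0⟩ := (Submodule.ne_bot_iff _).1 hker
  rw [LinearMap.mem_ker, Prod.ext_iff] at hc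
  set v := E c with hv
  have hvA : ∀ k, hA.eigenvectorBasis.repr v k = Function.extend Subtype.val c 0 k := fun k => by
    simp [hv, E]
  have hvB : ∀ k, t < hB.eigenvalues k → hB.eigenvectorBasis.repr v k = 0 := fun k hk =>
    congrFun hc.1 ⟨k, hk⟩
  have hvS : ∀ i ∈ S, v i = 0 := fun i hi => congrFun hc.2 ⟨i, hi⟩
  have hq := inner_toEuclideanLin_congr S h v hvS
  rw [inner_toEuclideanLin_eq_sum hA, inner_toEuclideanLin_eq_sum hB, ← Complex.ofReal_sum,
    ← Complex.ofReal_sum, Complex.ofReal_inj] at hq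
  have hn : ∑ k, ‖hA.eigenvectorBasis.repr v k‖ ^ 2 = ∑ k, ‖hB.eigenvectorBasis.repr v k‖ ^ 2 := by
    rw [← EuclideanSpace.norm_sq_eq, ← EuclideanSpace.norm_sq_eq, LinearIsometryEquiv.norm_map,
      LinearIsometryEquiv.norm_map]
  have hBle : ∑ k, hB.eigenvalues k * ‖hB.eigenvectorBasis.repr v k‖ ^ 2 ≤
      ∑ k, t * ‖hB.eigenvectorBasis.repr v k‖ ^ 2 := by
    refine Finset.sum_le_sum fun k _ => ?_
    by_cases hk : t < hB.eigenvalues k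
    · simp [hvB k hk]
    · push Not at hk
      gcongr
  obtain ⟨i₀, hi₀⟩ := Function.ne_iff.1 hc0
  have hAlt : ∑ k, t * ‖hA.eigenvectorBasis.repr v k‖ ^ 2 <
      ∑ k, hA.eigenvalues k * ‖hA.eigenvectorBasis.repr v k‖ ^ 2 := by
    refine Finset.sum_lt_sum (fun k _ => ?_) ⟨i₀, Finset.mem_univ _, ?_⟩
    · by_cases hk : t < hA.eigenvalues k
      · gcongr
      · have : ¬ ∃ a : I, (a : n) = k := fun ⟨a, ha⟩ => hk (ha ▸ a.2)
        simp [hvA, Function.extend_apply' _ _ _ this]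
    · have h1 : hA.eigenvectorBasis.repr v i₀ = c i₀ := by
        rw [hvA, Subtype.val_injective.extend_apply]
      rw [h1]
      have h2 : 0 < ‖c i₀‖ := norm_pos_iff.2 hi₀
      have h3 := i₀.2
      gcongr
  rw [← Finset.mul_sum, hn] at hAlt
  rw [← Finset.mul_sum] at hBle
  linarith

/-- The layer-cake formula for the ramp. -/
lemma setIntegral_indicator_Iio_eq_ramp (a b x : ℝ) :
    ∫ t in Set.Ico a b, (Set.Iio x).indicator (1 : ℝ → ℝ) t = ramp a b x := by
  rw [integral_indicator_one measurableSet_Iio, Measure.real,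
    Measure.restrict_apply measurableSet_Iio, Set.inter_comm, Set.Ico_inter_Iio,
    Real.volume_Ico, ramp]
  rcases le_total (min b x) a with h | h
  · rw [ENNReal.ofReal_of_nonpos (by linarith), max_eq_left (by rwa [min_comm])]; simp
  · rw [ENNReal.toReal_ofReal (by linarith), max_eq_right (by rwa [min_comm]), min_comm]

/-- A uniform comparison of counting functions yields a comparison of ramp sums, since the ramp is an
average of indicators of half-lines. -/
lemma sum_ramp_le_of_card_le {ι : Type*} [Fintype ι] {x y : ι → ℝ} {s : ℕ}
    (h : ∀ t, (Finset.univ.filter fun i => t < x i).card ≤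
      (Finset.univ.filter fun i => t < y i).card + s) {a b : ℝ} (hab : a ≤ b) :
    ∑ i, ramp a b (x i) ≤ ∑ i, ramp a b (y i) + (b - a) * s := by
  have hint : ∀ z : ℝ, Integrable ((Set.Iio z).indicator (1 : ℝ → ℝ))
      (volume.restrict (Set.Ico a b)) := fun z =>
    (integrable_const (1 : ℝ)).indicator measurableSet_Iio
  have hcount : ∀ (z : ι → ℝ) (t : ℝ), ∑ i, (Set.Iio (z i)).indicator (1 : ℝ → ℝ) t =
      (Finset.univ.filter fun i => t < z i).card := fun z t => by
    simp [Set.indicator_apply, Finset.sum_boole]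
  have h2 : (b - a) * s = ∫ _t in Set.Ico a b, (s : ℝ) := by simp [hab]
  simp_rw [← setIntegral_indicator_Iio_eq_ramp a b]
  rw [← integral_finsetSum _ fun i _ => hint _, ← integral_finsetSum _ fun i _ => hint _, h2,
    ← integral_add (integrable_finsetSum _ fun i _ => hint _) (integrable_const _)]
  refine integral_mono (integrable_finsetSum _ fun i _ => hint _)
    ((integrable_finsetSum _ fun i _ => hint _).add (integrable_const _)) fun t => ?_
  beta_reduce
  rw [hcount, hcount]
  exact_mod_cast h t

/-- Integrated form of the counting inequality: the trace of a ramp function moves by at most its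
height for each perturbed row. -/
theorem abs_sum_ramp_eigenvalues_sub_le {A B : Matrix n n ℂ} (hA : A.IsHermitian)
    (hB : B.IsHermitian) (S : Finset n) (h : ∀ i, i ∉ S → ∀ j, j ∉ S → A i j = B i j) {a b : ℝ}
    (hab : a ≤ b) :
    |∑ i, ramp a b (hA.eigenvalues i) - ∑ i, ramp a b (hB.eigenvalues i)| ≤ (b - a) * S.card := by
  have h1 := sum_ramp_le_of_card_le (card_eigenvalues_gt_le hA hB S h) hab
  have h2 := sum_ramp_le_of_card_le (card_eigenvalues_gt_le hB hA S
    fun i hi j hj => (h i hi j hj).symm) hab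
  rw [abs_le]
  constructor <;> linarith

/-! ### Traces of powers -/

lemma finRotate_castSucc {k : ℕ} (j : Fin k) : finRotate (k + 1) j.castSucc = j.succ := by
  ext
  rw [coe_finRotate_of_ne_last (Fin.castSucc_lt_last j).ne]
  simp

lemma trace_pow_eq_sum_eigenvalues {A : Matrix n n ℂ} (hA : A.IsHermitian) (k : ℕ) :
    (A ^ k).trace = ∑ i, ((hA.eigenvalues i ^ k : ℝ) : ℂ) := by
  conv_lhs => rw [hA.spectral_theorem, ← map_pow, Matrix.diagonal_pow]
  rw [Unitary.conjStarAlgAut_apply, Matrix.trace_mul_comm, ← mul_assoc]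
  simp [Matrix.trace]

/-- Spectral statistics of a measurable family of hermitian matrices are measurable: for monomials
they are traces of powers, and general continuous functions are approximated by polynomials. -/
lemma measurable_sum_eigenvalues {Ω : Type*} [MeasurableSpace Ω] {A : Ω → Matrix n n ℂ}
    (hA : ∀ ω, (A ω).IsHermitian) (hm : ∀ i j, Measurable fun ω => A ω i j) {g : ℝ → ℝ}
    (hg : Continuous g) : Measurable fun ω => ∑ i, g ((hA ω).eigenvalues i) := by
  have hpow : ∀ (k : ℕ) (i j : n), Measurable fun ω => (A ω ^ k) i j := fun k => by
    induction k with
    | zero => intro i j; simp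
    | succ k ih =>
      intro i j
      simp only [pow_succ, Matrix.mul_apply]
      exact Finset.measurable_fun_sum _ fun l _ => (ih i l).mul (hm l j)
  have hmono : ∀ k : ℕ, Measurable fun ω => ∑ i, (hA ω).eigenvalues i ^ k := fun k => by
    have h1 : (fun ω => ∑ i, (hA ω).eigenvalues i ^ k) = fun ω => (A ω ^ k).trace.re := by
      ext ω
      rw [trace_pow_eq_sum_eigenvalues (hA ω), ← Complex.ofReal_sum, Complex.ofReal_re]
    rw [h1]
    exact Complex.measurable_re.comp (Finset.measurable_fun_sum _ fun l _ => hpow k l l)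
  have hpoly : ∀ p : Polynomial ℝ, Measurable fun ω => ∑ i, p.eval ((hA ω).eigenvalues i) :=
    fun p => by
      simp_rw [Polynomial.eval_eq_sum_range]
      simp_rw [Finset.sum_comm (s := Finset.univ), ← Finset.mul_sum]
      exact Finset.measurable_fun_sum _ fun l _ => (hmono l).const_mul _
  have happrox : ∀ k : ℕ, ∃ p : Polynomial ℝ, ∀ x ∈ Set.Icc (-(k : ℝ)) k,
      |p.eval x - g x| < 1 / ((k : ℝ) + 1) := fun k =>
    exists_polynomial_near_of_continuousOn _ _ g hg.continuousOn _ (by positivity)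
  choose p hp using happrox
  refine measurable_of_tendsto_metrizable (fun k => hpoly (p k)) (tendsto_pi_nhds.2 fun ω => ?_)
  refine tendsto_finsetSum _ fun i _ => ?_
  rw [tendsto_iff_norm_sub_tendsto_zero]
  refine squeeze_zero' (.of_forall fun _ => norm_nonneg _) ?_
    tendsto_one_div_add_atTop_nhds_zero_nat
  filter_upwards [eventually_ge_atTop ⌈|(hA ω).eigenvalues i|⌉₊] with k hk
  exact (hp k _ (abs_le.1 (Nat.ceil_le.1 hk))).le

lemma pow_apply_eq_sum_paths {R : Type*} [CommSemiring R] (A : Matrix n n R) (k : ℕ) (a b : n) :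
    (A ^ k) a b = ∑ i : Fin (k + 1) → n, if i 0 = a ∧ i (Fin.last k) = b then
      ∏ j : Fin k, A (i j.castSucc) (i j.succ) else 0 := by
  induction k generalizing b with
  | zero =>
    rw [← (Equiv.funUnique (Fin 1) n).symm.sum_comp]
    simp only [pow_zero, Matrix.one_apply, Finset.univ_eq_empty, Finset.prod_empty]
    simp [ite_and]
  | succ k ih =>
    rw [pow_succ, Matrix.mul_apply, ← (Fin.snocEquiv fun _ => n).sum_comp,
      Fintype.sum_prod_type_right]
    simp_rw [ih, Finset.sum_mul]
    rw [Finset.sum_comm]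
    refine Finset.sum_congr rfl fun i _ => ?_
    have : ∀ x : n, Fin.snoc (α := fun _ => n) i x 0 = i 0 := fun x =>
      Fin.snoc_castSucc (α := fun _ => n) x i 0
    simp only [Fin.snocEquiv, Equiv.coe_fn_mk, Fin.prod_univ_castSucc, Fin.snoc_last,
      Fin.snoc_castSucc, Fin.succ_last, ← Fin.castSucc_succ, this]
    by_cases h0 : i 0 = a
    · simp [h0, ite_mul]
    · simp [h0]

/-- The trace of a power as a sum over closed walks. -/
theorem trace_pow_eq_sum_cycles {R : Type*} [CommSemiring R] (A : Matrix n n R) {k : ℕ}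
    (hk : k ≠ 0) :
    (A ^ k).trace = ∑ i : Fin k → n, ∏ j, A (i j) (i (finRotate k j)) := by
  obtain ⟨k, rfl⟩ := Nat.exists_eq_succ_of_ne_zero hk
  simp only [Nat.succ_eq_add_one, Matrix.trace, Matrix.diag_apply, pow_succ, Matrix.mul_apply,
    pow_apply_eq_sum_paths, Finset.sum_mul]
  rw [Finset.sum_congr rfl fun a _ => Finset.sum_comm, Finset.sum_comm]
  refine Finset.sum_congr rfl fun i _ => ?_
  rw [Fin.prod_univ_castSucc]
  simp only [ite_mul, zero_mul, finRotate_last, ite_and]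
  simp

end Spectral

/-! ### Concentration of functions with bounded differences -/

/-- McDiarmid's inequality: a bounded function of `n` independent variables that changes by at most
`c` when one variable changes is sub-Gaussian about its mean.  Averaging out one variable at a time,
each step costs a factor controlled by Hoeffding's lemma. -/
theorem hasSubgaussianMGF_of_bounded_differences {E : Type*} [MeasurableSpace E] (μ : Measure E)
    [IsProbabilityMeasure μ] {n : ℕ} {F : (Fin n → E) → ℝ} (hF : Measurable F) {B : ℝ}
    (hB : ∀ x, |F x| ≤ B) {c : NNReal}
    (hc : ∀ x i y, |F (Function.update x i y) - F x| ≤ c) :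
    HasSubgaussianMGF (fun x => F x - ∫ z, F z ∂Measure.pi fun _ => μ) (n * c ^ 2)
      (Measure.pi fun _ => μ) := by
  have hint : ∀ {m : ℕ} {H : (Fin m → E) → ℝ}, Measurable H → (∀ x, |H x| ≤ B) → ∀ s t : ℝ,
      Integrable (fun x => Real.exp (t * (H x - s))) (Measure.pi fun _ => μ) :=
    fun hH hHB s t => by
      refine (integrable_const (Real.exp (|t| * (B + |s|)))).mono'
        (((hH.sub_const _).const_mul _).exp).aestronglyMeasurable (ae_of_all _ fun x => ?_)
      rw [Real.norm_of_nonneg (Real.exp_pos _).le, Real.exp_le_exp]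
      refine (le_abs_self _).trans ?_
      rw [abs_mul]
      gcongr
      exact (abs_sub _ _).trans (by gcongr; exact hHB x)
  refine ⟨hint hF hB _, fun t => ?_⟩
  induction n with
  | zero =>
    have : ∀ x, F x = F default := fun x => congrArg F (Subsingleton.elim _ _)
    simp [mgf, this]
  | succ n ih =>
    have hmp := (measurePreserving_piFinSuccAbove (fun _ : Fin (n + 1) => μ) 0).symm
    let e := (MeasurableEquiv.piFinSuccAbove (fun _ : Fin (n + 1) => E) 0).symm
    have he : ∀ x y, e (x, y) = Fin.cons x y := fun x y => Fin.insertNth_zero' x y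
    have hFe : Measurable fun z : E × (Fin n → E) => F (e z) := hF.comp e.measurable
    have hFy : ∀ y, Measurable fun x => F (Fin.cons x y) := fun y => by
      simpa only [Function.comp_def, he, id_eq] using
        hFe.comp (measurable_id.prodMk (measurable_const (a := y)))
    let G : (Fin n → E) → ℝ := fun y => ∫ x, F (Fin.cons x y) ∂μ
    have hG : Measurable G := by
      simpa only [he] using (hFe.stronglyMeasurable.integral_prod_left' (μ := μ)).measurable
    have hFi : ∀ y, Integrable (fun x => F (Fin.cons x y)) μ := fun y =>
      (integrable_const B).mono' (hFy y).aestronglyMeasurable (ae_of_all _ fun x => hB _)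
    have hGB : ∀ y, |G y| ≤ B := fun y => by
      have := norm_integral_le_of_norm_le_const (μ := μ) (f := fun x => F (Fin.cons x y))
        (ae_of_all _ fun x => hB (Fin.cons x y))
      simpa using this
    have hGc : ∀ y i z, |G (Function.update y i z) - G y| ≤ c := fun y i z => by
      simp only [G]
      rw [← integral_sub (hFi _) (hFi _)]
      have := norm_integral_le_of_norm_le_const (μ := μ)
        (f := fun x => F (Fin.cons x (Function.update y i z)) - F (Fin.cons x y)) (C := c)
        (ae_of_all _ fun x => by rw [Fin.cons_update]; exact hc _ _ _)
      simpa using this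
    have hbdd : Integrable (fun z : E × (Fin n → E) => F (e z)) (μ.prod (Measure.pi fun _ => μ)) :=
      (integrable_const B).mono' hFe.aestronglyMeasurable (ae_of_all _ fun x => hB _)
    have hEF : ∫ z, F z ∂(Measure.pi fun _ => μ) = ∫ y, G y ∂(Measure.pi fun _ => μ) := by
      rw [← hmp.integral_comp' (g := F)]
      refine (integral_prod_symm _ hbdd).trans ?_
      simp only [he, G]
    rw [hEF]
    set m := ∫ y, G y ∂(Measure.pi fun _ => μ)
    have hinner : ∀ y, ∫ x, Real.exp (t * (F (Fin.cons x y) - G y)) ∂μ ≤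
        Real.exp (c ^ 2 * t ^ 2 / 2) := fun y => by
      obtain ⟨x₀⟩ : Nonempty E := (inferInstance : NeBot (ae μ)).nonempty
      have h1 := hasSubgaussianMGF_of_mem_Icc (μ := μ) (X := fun x => F (Fin.cons x y))
        (a := F (Fin.cons x₀ y) - c) (b := F (Fin.cons x₀ y) + c) (hFy y).aemeasurable
        (ae_of_all _ fun x => by
          have := hc (Fin.cons x₀ y) 0 x
          rw [Fin.update_cons_zero, abs_le] at this
          constructor <;> linarith)
      have h2 := h1.mgf_le t
      have h3 : ((‖F (Fin.cons x₀ y) + c - (F (Fin.cons x₀ y) - c)‖₊ / 2) ^ 2 : NNReal) =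
          c ^ 2 := by
        congr 1
        ext
        push_cast
        rw [show F (Fin.cons x₀ y) + c - (F (Fin.cons x₀ y) - c) = 2 * (c : ℝ) by ring,
          Real.norm_of_nonneg (by positivity)]
        ring
      rw [h3] at h2
      simpa [mgf] using h2
    have hexp : Integrable (fun z : E × (Fin n → E) => Real.exp (t * (F (e z) - m)))
        (μ.prod (Measure.pi fun _ => μ)) :=
      (hmp.integrable_comp_emb e.measurableEmbedding).2 (hint hF hB m t)
    calc mgf (fun x => F x - m) (Measure.pi fun _ => μ) t
        = ∫ y, ∫ x, Real.exp (t * (F (Fin.cons x y) - m)) ∂μ ∂(Measure.pi fun _ => μ) := by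
          rw [mgf, ← hmp.integral_comp' (g := fun x => Real.exp (t * (F x - m)))]
          refine (integral_prod_symm _ hexp).trans ?_
          simp only [he]
      _ ≤ ∫ y, Real.exp (c ^ 2 * t ^ 2 / 2) * Real.exp (t * (G y - m))
            ∂(Measure.pi fun _ => μ) := by
          have hexp' := hexp.integral_prod_right
          simp only [he] at hexp'
          refine integral_mono hexp' ((hint hG hGB m t).const_mul _) fun y => ?_
          have h1 : ∀ x, Real.exp (t * (F (Fin.cons x y) - m)) =
              Real.exp (t * (F (Fin.cons x y) - G y)) * Real.exp (t * (G y - m)) := fun x => by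
            rw [← Real.exp_add]; ring_nf
          simp_rw [h1]
          rw [integral_mul_const]
          exact mul_le_mul_of_nonneg_right (hinner y) (Real.exp_pos _).le
      _ = Real.exp (c ^ 2 * t ^ 2 / 2) * mgf (fun y => G y - m) (Measure.pi fun _ => μ) t := by
          rw [integral_const_mul]; rfl
      _ ≤ Real.exp (c ^ 2 * t ^ 2 / 2) * Real.exp ((n * c ^ 2 : NNReal) * t ^ 2 / 2) := by
          gcongr
          exact ih hG hGB hGc
      _ = Real.exp (((n + 1 : ℕ) * c ^ 2 : NNReal) * t ^ 2 / 2) := by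
          rw [← Real.exp_add]
          push_cast
          ring_nf

/-- Almost sure convergence to the mean, whatever the joint law for different `n`: a statistic of `n`
independent points with differences bounded by `K / n` has summable deviation probabilities. -/
theorem ae_tendsto_sub_mean_of_bounded_differences {E S : Type*} [MeasurableSpace E]
    [MeasurableSpace S] {P : Measure S} [IsProbabilityMeasure P] (μ : ℕ → Measure E)
    [∀ n, IsProbabilityMeasure (μ n)] {X : (n : ℕ) → Fin n → S → E}
    (hX : ∀ n i, Measurable (X n i)) (hind : ∀ n, iIndepFun (X n) P)
    (hlaw : ∀ n i, P.map (X n i) = μ n) {F : (n : ℕ) → (Fin n → E) → ℝ}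
    (hF : ∀ n, Measurable (F n)) {B : ℝ} (hB : ∀ n x, |F n x| ≤ B) {K : NNReal} (hK : 0 < K)
    (hc : ∀ n x i y, |F n (Function.update x i y) - F n x| ≤ (K : ℝ) / n) :
    ∀ᵐ ω ∂P, Tendsto (fun n => F n (fun i => X n i ω) - ∫ z, F n z ∂Measure.pi fun _ => μ n)
      atTop (𝓝 0) := by
  have hmap : ∀ n, P.map (fun ω i => X n i ω) = Measure.pi fun _ => μ n := fun n => by
    rw [(iIndepFun_iff_map_fun_eq_pi_map fun i => (hX n i).aemeasurable).1 (hind n)]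
    simp_rw [hlaw]
  let D : ℕ → S → ℝ := fun n ω => F n (fun i => X n i ω) - ∫ z, F n z ∂Measure.pi fun _ => μ n
  have hsub : ∀ n : ℕ, HasSubgaussianMGF (D n) (n * (K / n) ^ 2) P := fun n => by
    have h1 := hasSubgaussianMGF_of_bounded_differences (μ n) (hF n) (hB n) (c := K / n)
      (fun x i y => by simpa using hc n x i y)
    rw [← hmap n] at h1
    have h2 := h1.of_map (measurable_pi_lambda _ fun i => hX n i).aemeasurable
    rw [hmap n] at h2
    exact h2
  have htail : ∀ ε : ℝ, 0 < ε → ∀ᵐ ω ∂P, ∀ᶠ n in atTop, |D n ω| < ε := fun ε hε => by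
    have hq : Real.exp (-(ε ^ 2 / (2 * (K : ℝ) ^ 2))) < 1 := by
      rw [Real.exp_lt_one_iff]
      have : 0 < ε ^ 2 / (2 * (K : ℝ) ^ 2) := by positivity
      linarith
    have hsum : Summable fun n : ℕ => 2 * Real.exp (-(ε ^ 2 / (2 * (K : ℝ) ^ 2))) ^ n :=
      (summable_geometric_of_lt_one (Real.exp_pos _).le hq).mul_left 2
    have hbound : ∀ n : ℕ, P {ω | ε ≤ |D n ω|} ≤
        ENNReal.ofReal (2 * Real.exp (-(ε ^ 2 / (2 * (K : ℝ) ^ 2))) ^ n) := fun n => by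
      have h3 : Real.exp (-ε ^ 2 / (2 * (n * (K / n) ^ 2 : NNReal))) ≤
          Real.exp (-(ε ^ 2 / (2 * (K : ℝ) ^ 2))) ^ n := by
        rw [← Real.exp_nat_mul]
        apply le_of_eq
        congr 1
        push_cast
        rcases eq_or_ne n 0 with rfl | hn
        · simp
        · have : (n : ℝ) ≠ 0 := by exact_mod_cast hn
          have hK' : (K : ℝ) ≠ 0 := by exact_mod_cast hK.ne'
          field_simp
      have h1 := (hsub n).measure_ge_le hε.le
      have h2 := (hsub n).neg.measure_ge_le hε.le
      have h4 : {ω | ε ≤ |D n ω|} = {ω | ε ≤ D n ω} ∪ {ω | ε ≤ (-D n) ω} := by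
        ext ω; simp [le_abs]
      rw [h4]
      refine (measure_union_le _ _).trans ?_
      rw [← ENNReal.ofReal_toReal (measure_ne_top P {ω | ε ≤ D n ω}),
        ← ENNReal.ofReal_toReal (measure_ne_top P {ω | ε ≤ (-D n) ω}),
        ← ENNReal.ofReal_add ENNReal.toReal_nonneg ENNReal.toReal_nonneg]
      refine ENNReal.ofReal_le_ofReal ?_
      rw [two_mul]
      exact add_le_add (h1.trans h3) (h2.trans h3)
    have hne : ∑' n, P {ω | ε ≤ |D n ω|} ≠ ⊤ :=
      ne_top_of_le_ne_top hsum.tsum_ofReal_ne_top (ENNReal.tsum_le_tsum hbound)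
    filter_upwards [ae_eventually_notMem hne] with ω hω
    filter_upwards [hω] with n hn
    simpa using hn
  have hall := ae_all_iff.2 fun k : ℕ => htail (1 / ((k : ℝ) + 1)) (by positivity)
  filter_upwards [hall] with ω hω
  rw [Metric.tendsto_nhds]
  intro ε hε
  obtain ⟨k, hk⟩ := exists_nat_one_div_lt hε
  filter_upwards [hω k] with n hn
  rw [Real.dist_0_eq_abs]
  exact hn.trans hk

/-! ### Uniform points in a cube -/

lemma measurableSet_centredCube (d : ℕ) (r : ℝ) : MeasurableSet (centredCube d r) :=
  measurableSet_Icc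

lemma volume_centredCube (d : ℕ) (r : ℝ) : volume (centredCube d r) = ENNReal.ofReal r ^ d := by
  rw [centredCube, Real.volume_Icc_pi]
  simp only [Finset.prod_const, Finset.card_univ, Fintype.card_fin]
  congr 2
  ring

/-- The uniform distribution on the cube `[-r/2, r/2]^d`. -/
noncomputable def cubeLaw (d : ℕ) (r : ℝ) : Measure (Fin d → ℝ) :=
  ProbabilityTheory.cond volume (centredCube d r)

lemma isProbabilityMeasure_cubeLaw (d : ℕ) {r : ℝ} (hr : 0 < r) :
    IsProbabilityMeasure (cubeLaw d r) :=
  cond_isProbabilityMeasure_of_finite (by rw [volume_centredCube]; positivity)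
    (by rw [volume_centredCube]; exact ENNReal.pow_ne_top ENNReal.ofReal_ne_top)

lemma cubeLaw_eq (d : ℕ) {r : ℝ} (hr : 0 < r) :
    cubeLaw d r = ENNReal.ofReal (r⁻¹ ^ d) • volume.restrict (centredCube d r) := by
  rw [cubeLaw, ProbabilityTheory.cond, volume_centredCube, ← ENNReal.ofReal_pow hr.le,
    ← ENNReal.ofReal_inv_of_pos (by positivity), inv_pow]

/-- The density of the uniform distribution is at most `r⁻ᵈ`, so that two independent points are in
relative position `B` with probability at most `r⁻ᵈ |B|`. -/
lemma cubeLaw_sub_mem_le (d : ℕ) {r : ℝ} (hr : 0 < r) {B : Set (Fin d → ℝ)} (hB : MeasurableSet B)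
    (x : Fin d → ℝ) :
    cubeLaw d r {y | x - y ∈ B} ≤ ENNReal.ofReal (r⁻¹ ^ d) * volume B := by
  rw [cubeLaw_eq d hr, Measure.smul_apply, smul_eq_mul]
  refine mul_le_mul_right ?_ _
  refine (Measure.restrict_apply_le _ _).trans ?_
  exact ((Measure.measurePreserving_sub_left volume x).measure_preimage hB.nullMeasurableSet).le

/-! ### Products along closed walks -/

/-- The product of the entries `f (x_{i(j)} - x_{i(j+1)})` along the closed walk `i`. -/
def walkProduct {d k : ℕ} {ι : Type*} (f : (Fin d → ℝ) → ℂ) (i : Fin k → ι)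
    (x : ι → Fin d → ℝ) : ℂ :=
  ∏ j, f (x (i j) - x (i (finRotate k j)))

lemma measurable_walkProduct {d k : ℕ} {ι : Type*} {f : (Fin d → ℝ) → ℂ} (hf : Measurable f)
    (i : Fin k → ι) : Measurable (walkProduct f i) :=
  Finset.measurable_fun_prod _ fun _ _ =>
    hf.comp ((measurable_pi_apply _).sub (measurable_pi_apply _))

lemma norm_walkProduct_le {d k : ℕ} {ι : Type*} {f : (Fin d → ℝ) → ℂ} {C : ℝ}
    (hC : ∀ x, ‖f x‖ ≤ C) (i : Fin k → ι) (x : ι → Fin d → ℝ) : ‖walkProduct f i x‖ ≤ C ^ k := by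
  rw [walkProduct, norm_prod]
  calc _ ≤ ∏ _j : Fin k, C := Finset.prod_le_prod (fun _ _ => norm_nonneg _) fun _ _ => hC _
    _ = C ^ k := by simp

/-- Integrating out one coordinate: if `G` does not depend on the coordinate `a` and `H` has integral
at most `c` over that coordinate, then the integral of `G * H` is at most `c` times that of `G`. -/
lemma lintegral_pi_mul_le {ι E : Type*} [Fintype ι] [DecidableEq ι] [MeasurableSpace E]
    (μ : Measure E) [IsProbabilityMeasure μ] (a : ι)
    {G H : (ι → E) → ENNReal} (hG : Measurable G) (hH : Measurable H)
    (hGa : ∀ x y, G (Function.update x a y) = G x) {c : ENNReal}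
    (hc : ∀ x, ∫⁻ y, H (Function.update x a y) ∂μ ≤ c) :
    ∫⁻ x, G x * H x ∂(Measure.pi fun _ => μ) ≤ c * ∫⁻ x, G x ∂(Measure.pi fun _ => μ) := by
  rw [← lintegral_const_mul c hG]
  refine lintegral_le_of_lmarginal_le {a} (hG.mul hH) (hG.const_mul c) fun x => ?_
  simp only [lmarginal_singleton, hGa, lintegral_const, measure_univ, mul_one]
  rw [lintegral_const_mul (G x) (f := fun y => H (Function.update x a y))
    (hH.comp (measurable_update x)), mul_comm c]
  gcongr
  exact hc x

/-- A walk on independent random points takes steps in `B` with probability at most `c ^ (v - 1)`,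
where `v` is the number of points visited: each newly visited point has to be close to a point
visited before it. -/
lemma lintegral_path_le {d : ℕ} {ι : Type*} [Fintype ι] [DecidableEq ι]
    (μ : Measure (Fin d → ℝ)) [IsProbabilityMeasure μ] {B : Set (Fin d → ℝ)} (hB : MeasurableSet B)
    {c : ENNReal} (hc : ∀ x, μ {y | x - y ∈ B} ≤ c) (k : ℕ) (φ : Fin (k + 1) → ι) :
    ∫⁻ x, ∏ j : Fin k, B.indicator (1 : (Fin d → ℝ) → ENNReal) (x (φ j.castSucc) - x (φ j.succ))
        ∂(Measure.pi fun _ : ι => μ) ≤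
      c ^ ((Finset.univ.image φ).card - 1) := by
  have hmeas : ∀ a b : ι, Measurable fun x : ι → Fin d → ℝ =>
      B.indicator (1 : (Fin d → ℝ) → ENNReal) (x a - x b) := fun a b =>
    (measurable_one.indicator hB).comp ((measurable_pi_apply _).sub (measurable_pi_apply _))
  induction k with
  | zero => simp [Finset.univ_unique]
  | succ k ih =>
    have himg : Finset.univ.image φ =
        insert (φ (Fin.last _)) (Finset.univ.image fun j : Fin (k + 1) => φ j.castSucc) := by
      ext a
      simp only [Finset.mem_image, Finset.mem_univ, true_and, Finset.mem_insert]
      rw [Fin.exists_fin_succ']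
      tauto
    have h1 := ih fun j => φ j.castSucc
    simp_rw [Fin.prod_univ_castSucc, Fin.succ_last, Fin.succ_castSucc]
    by_cases hmem : φ (Fin.last _) ∈ Finset.univ.image fun j : Fin (k + 1) => φ j.castSucc
    · rw [himg, Finset.insert_eq_of_mem hmem]
      refine le_trans (lintegral_mono fun x => ?_) h1
      refine mul_le_of_le_one_right' ?_
      exact Set.indicator_apply_le' (fun _ => le_rfl) (fun _ => zero_le_one)
    · have hne : ∀ j : Fin (k + 1), φ j.castSucc ≠ φ (Fin.last _) := fun j h =>
        hmem (Finset.mem_image.2 ⟨j, Finset.mem_univ _, h⟩)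
      have hpos : 0 < (Finset.univ.image fun j : Fin (k + 1) => φ j.castSucc).card :=
        Finset.card_pos.2 (Finset.univ_nonempty.image _)
      rw [himg, Finset.card_insert_of_notMem hmem, Nat.add_sub_cancel]
      refine (lintegral_pi_mul_le μ (φ (Fin.last _))
        (Finset.measurable_fun_prod _ fun j _ => hmeas _ _) (hmeas _ _) (fun x y => ?_)
        (c := c) (fun x => ?_)).trans ?_
      · refine Finset.prod_congr rfl fun j _ => ?_
        rw [Function.update_of_ne (hne _), Function.update_of_ne (hne _)]
      · have h2 : ∀ b, MeasurableSet {y | b - y ∈ B} := fun b => (measurable_const_sub b) hB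
        simp only [Function.update_of_ne (hne _), Function.update_self]
        refine le_trans (le_of_eq ?_) (hc (x (φ (Fin.last k).castSucc)))
        rw [← lintegral_indicator_one (h2 _)]
        rfl
      · rw [← Nat.sub_add_cancel hpos, pow_succ, mul_comm]
        gcongr

section Moments

variable {d : ℕ} {f : (Fin d → ℝ) → ℂ} {C : ℝ}

/-- The expectation of a product along a closed walk with `v` vertices is of order `c ^ (v - 1)`. -/
lemma norm_integral_walkProduct_le (hsupp : Function.support f ⊆ centredCube d 1)
    (hC : ∀ x, ‖f x‖ ≤ C) {ι : Type*} [Fintype ι] [DecidableEq ι]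
    (μ : Measure (Fin d → ℝ)) [IsProbabilityMeasure μ] {c : ℝ} (hc0 : 0 ≤ c)
    (hc : ∀ x, μ {y | x - y ∈ centredCube d 1} ≤ ENNReal.ofReal c) {k : ℕ} (hk : k ≠ 0)
    (i : Fin k → ι) :
    ‖∫ x, walkProduct f i x ∂(Measure.pi fun _ : ι => μ)‖ ≤
      C ^ k * c ^ ((Finset.univ.image i).card - 1) := by
  have hC0 : 0 ≤ C := (norm_nonneg _).trans (hC 0)
  obtain ⟨k, rfl⟩ := Nat.exists_eq_succ_of_ne_zero hk
  have hpt : ∀ x, ‖walkProduct f i x‖ₑ ≤ ENNReal.ofReal (C ^ (k + 1)) *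
      ∏ j : Fin k, (centredCube d 1).indicator (1 : (Fin d → ℝ) → ENNReal)
        (x (i j.castSucc) - x (i j.succ)) := fun x => by
    by_cases h : ∀ j : Fin k, x (i j.castSucc) - x (i j.succ) ∈ centredCube d 1
    · simp only [Set.indicator_of_mem (h _), Pi.one_apply, Finset.prod_const_one, mul_one]
      rw [← ofReal_norm]
      exact ENNReal.ofReal_le_ofReal (norm_walkProduct_le hC i x)
    · push Not at h
      obtain ⟨j, hj⟩ := h
      have h0 : walkProduct f i x = 0 := by
        refine Finset.prod_eq_zero (Finset.mem_univ j.castSucc) ?_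
        rw [finRotate_castSucc]
        exact Function.notMem_support.1 fun h => hj (hsupp h)
      simp [h0]
  have h1 : ‖∫ x, walkProduct f i x ∂(Measure.pi fun _ : ι => μ)‖ₑ ≤
      ENNReal.ofReal (C ^ (k + 1) * c ^ ((Finset.univ.image i).card - 1)) := by
    refine (enorm_integral_le_lintegral_enorm _).trans ((lintegral_mono hpt).trans ?_)
    rw [lintegral_const_mul' _ _ ENNReal.ofReal_ne_top, ENNReal.ofReal_mul (by positivity),
      ENNReal.ofReal_pow hc0]
    gcongr
    exact lintegral_path_le μ (measurableSet_centredCube d 1) hc k i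
  rw [← ofReal_norm] at h1
  exact (ENNReal.ofReal_le_ofReal_iff (by positivity)).1 h1

/-- The number of maps into `Fin n` whose image has `p` elements is at most `n ^ p / p! * p ^ k`. -/
lemma sum_card_image_le {k n : ℕ} {g : ℕ → ℝ} (hg : ∀ p, 0 ≤ g p) :
    ∑ i : Fin k → Fin n, g (Finset.univ.image i).card ≤
      ∑ p ∈ Finset.range (k + 1), (n : ℝ) ^ p / p.factorial * (p : ℝ) ^ k * g p := by
  have h1 : ∀ i : Fin k → Fin n, (Finset.univ.image i).card ∈ Finset.range (k + 1) := fun i => by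
    rw [Finset.mem_range, Nat.lt_succ_iff]
    exact Finset.card_image_le.trans (by simp)
  rw [← Finset.sum_fiberwise_of_maps_to (fun i _ => h1 i)]
  refine Finset.sum_le_sum fun p _ => ?_
  rw [Finset.sum_congr rfl (g := fun _ => g p) fun i hi => by rw [(Finset.mem_filter.1 hi).2],
    Finset.sum_const, nsmul_eq_mul]
  refine mul_le_mul_of_nonneg_right ?_ (hg p)
  have h2 : (Finset.univ.filter fun i : Fin k → Fin n => (Finset.univ.image i).card = p) ⊆
      (Finset.univ.powersetCard p).biUnion fun T : Finset (Fin n) =>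
        Fintype.piFinset fun _ : Fin k => T := fun i hi => by
    rw [Finset.mem_biUnion]
    exact ⟨Finset.univ.image i, Finset.mem_powersetCard.2 ⟨Finset.subset_univ _,
      (Finset.mem_filter.1 hi).2⟩, Fintype.mem_piFinset.2 fun j =>
        Finset.mem_image_of_mem _ (Finset.mem_univ j)⟩
  have h3 : (Finset.univ.filter fun i : Fin k → Fin n => (Finset.univ.image i).card = p).card ≤
      n.choose p * p ^ k := by
    refine (Finset.card_le_card h2).trans ((Finset.card_biUnion_le_card_mul _ _ (p ^ k)
      fun T hT => ?_).trans ?_)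
    · simp [(Finset.mem_powersetCard.1 hT).2]
    · simp
  calc (_ : ℝ) ≤ (n.choose p * p ^ k : ℕ) := by exact_mod_cast h3
    _ = (n.choose p : ℝ) * (p : ℝ) ^ k := by push_cast; ring
    _ ≤ _ := by gcongr; exact Nat.choose_le_pow_div p n

/-- The expected normalised trace of the `k`-th power of the Euclidean matrix of `n` independent
points with law `μ`. -/
noncomputable def meanMoment (f : (Fin d → ℝ) → ℂ) (μ : Measure (Fin d → ℝ)) (n k : ℕ) : ℂ :=
  (n : ℂ)⁻¹ * ∫ x, (euclideanMatrix f x ^ k).trace ∂(Measure.pi fun _ : Fin n => μ)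

lemma integrable_walkProduct (hf : Measurable f) (hC : ∀ x, ‖f x‖ ≤ C) {ι : Type*} [Fintype ι]
    {k : ℕ} (μ : Measure (ι → Fin d → ℝ)) [IsFiniteMeasure μ] (i : Fin k → ι) :
    Integrable (walkProduct f i) μ :=
  (integrable_const (C ^ k)).mono' (measurable_walkProduct hf i).aestronglyMeasurable
    (ae_of_all _ (norm_walkProduct_le hC i))

lemma meanMoment_eq_sum (hf : Measurable f) (hC : ∀ x, ‖f x‖ ≤ C) (μ : Measure (Fin d → ℝ))
    [IsProbabilityMeasure μ] (n : ℕ) {k : ℕ} (hk : k ≠ 0) :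
    meanMoment f μ n k = (n : ℂ)⁻¹ * ∑ i : Fin k → Fin n,
      ∫ x, walkProduct f i x ∂(Measure.pi fun _ : Fin n => μ) := by
  rw [meanMoment, ← integral_finsetSum _ fun i _ => integrable_walkProduct hf hC _ i]
  simp_rw [trace_pow_eq_sum_cycles _ hk]
  rfl

lemma meanMoment_zero (μ : Measure (Fin d → ℝ)) [IsProbabilityMeasure μ] {n : ℕ} (hn : n ≠ 0) :
    meanMoment f μ n 0 = 1 := by
  have : (n : ℂ) ≠ 0 := by exact_mod_cast hn
  simp [meanMoment, this]

/-- The majorant `Cᵏ ∑_{p ≥ 1} p^k G^{p-1} / p!` of the `k`-th moments.  By Dobiński's formula the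
series equals `G⁻¹ e^G` times the `k`-th Touchard polynomial at `G` if `k ≥ 1` and `G > 0`. -/
noncomputable def momentBound (C G : ℝ) (k : ℕ) : ℝ :=
  C ^ k * ∑' q : ℕ, G ^ q / (q + 1).factorial * ((q : ℝ) + 1) ^ k

lemma summable_momentBound_aux {G s : ℝ} (hG : 0 ≤ G) (hs : 0 ≤ s) :
    Summable fun p : ℕ × ℕ =>
      G ^ p.1 / (p.1 + 1).factorial * (((p.1 : ℝ) + 1) * s) ^ p.2 / p.2.factorial := by
  have hexp : ∀ q : ℕ, HasSum (fun k : ℕ => (((q : ℝ) + 1) * s) ^ k / k.factorial)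
      (Real.exp (((q : ℝ) + 1) * s)) := fun q => by
    rw [Real.exp_eq_exp_ℝ]
    exact NormedSpace.expSeries_div_hasSum_exp _
  refine (summable_prod_of_nonneg fun p => by simp only [Pi.zero_apply]; positivity).2 ⟨fun q => ?_, ?_⟩
  · simp only [mul_div_assoc]
    exact (hexp q).summable.mul_left _
  · simp only [mul_div_assoc]
    have : ∀ q : ℕ, ∑' k : ℕ, G ^ q / ((q + 1).factorial : ℝ) *
        ((((q : ℝ) + 1) * s) ^ k / k.factorial) =
        G ^ q / (q + 1).factorial * Real.exp (((q : ℝ) + 1) * s) := fun q => by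
      rw [tsum_mul_left, (hexp q).tsum_eq]
    simp only [this]
    refine Summable.of_nonneg_of_le (fun q => by positivity) (fun q => ?_)
      ((Real.summable_pow_div_factorial (G * Real.exp s)).mul_left (Real.exp s))
    have h1 : Real.exp (((q : ℝ) + 1) * s) = Real.exp s ^ q * Real.exp s := by
      rw [add_mul, one_mul, Real.exp_add, Real.exp_nat_mul]
    have h2 : ((q.factorial : ℕ) : ℝ) ≤ (q + 1).factorial := by
      exact_mod_cast Nat.factorial_le (Nat.le_succ q)
    calc G ^ q / (q + 1).factorial * Real.exp (((q : ℝ) + 1) * s)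
        ≤ G ^ q / q.factorial * Real.exp (((q : ℝ) + 1) * s) := by gcongr
      _ = Real.exp s * ((G * Real.exp s) ^ q / q.factorial) := by rw [h1, mul_pow]; ring

lemma summable_momentBound_term {G : ℝ} (hG : 0 ≤ G) (k : ℕ) :
    Summable fun q : ℕ => G ^ q / (q + 1).factorial * ((q : ℝ) + 1) ^ k := by
  have h := ((summable_momentBound_aux hG zero_le_one).prod_symm.prod_factor k).mul_left
    (k.factorial : ℝ)
  refine h.congr fun q => ?_
  have : (k.factorial : ℝ) ≠ 0 := by positivity
  simp only [Prod.swap, mul_one]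
  field_simp

/-- The majorants grow slowly enough for the exponential series of the moments to converge. -/
lemma summable_momentBound {C G : ℝ} (hC : 0 ≤ C) (hG : 0 ≤ G) {s : ℝ} (hs : 0 ≤ s) :
    Summable fun k : ℕ => s ^ k / k.factorial * momentBound C G k := by
  have h := (summable_momentBound_aux hG (mul_nonneg hs hC)).prod_symm.prod
  refine h.congr fun k => ?_
  rw [momentBound, ← mul_assoc, ← tsum_mul_left]
  refine tsum_congr fun q => ?_
  simp only [Prod.swap, mul_pow]
  ring

lemma momentBound_nonneg {C G : ℝ} (hC : 0 ≤ C) (hG : 0 ≤ G) (k : ℕ) : 0 ≤ momentBound C G k :=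
  mul_nonneg (by positivity) (tsum_nonneg fun q => by positivity)

/-- If a point is close to a given one with probability at most `c`, and `n c ≤ G`, the mean moments
for `n` points have a bound that depends on `G` but not on `n`. -/
lemma norm_meanMoment_le (hf : Measurable f) (hsupp : Function.support f ⊆ centredCube d 1)
    (hC : ∀ x, ‖f x‖ ≤ C) (μ : Measure (Fin d → ℝ)) [IsProbabilityMeasure μ] {c : ℝ} (hc0 : 0 ≤ c)
    (hc : ∀ x, μ {y | x - y ∈ centredCube d 1} ≤ ENNReal.ofReal c) {n : ℕ} {G : ℝ}
    (hG : n * c ≤ G) (k : ℕ) : ‖meanMoment f μ n k‖ ≤ momentBound C G k := by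
  have hC0 : 0 ≤ C := (norm_nonneg _).trans (hC 0)
  have hG0 : 0 ≤ G := le_trans (by positivity) hG
  rcases eq_or_ne n 0 with rfl | hn
  · simpa [meanMoment] using momentBound_nonneg hC0 hG0 k
  have hn0 : (n : ℝ) ≠ 0 := by exact_mod_cast hn
  rcases eq_or_ne k 0 with rfl | hk
  · rw [meanMoment_zero μ hn, momentBound]
    have := (summable_momentBound_term hG0 0).le_tsum 0 fun q _ => by positivity
    simpa using this
  rw [meanMoment_eq_sum hf hC μ n hk, norm_mul, norm_inv, Complex.norm_natCast]
  calc (n : ℝ)⁻¹ * ‖∑ i : Fin k → Fin n, ∫ x, walkProduct f i x ∂(Measure.pi fun _ : Fin n => μ)‖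
      ≤ (n : ℝ)⁻¹ * ∑ i : Fin k → Fin n, C ^ k * c ^ ((Finset.univ.image i).card - 1) := by
        gcongr
        exact norm_sum_le_of_le _ fun i _ => norm_integral_walkProduct_le hsupp hC μ hc0 hc hk i
    _ ≤ (n : ℝ)⁻¹ * ∑ p ∈ Finset.range (k + 1),
          (n : ℝ) ^ p / p.factorial * (p : ℝ) ^ k * (C ^ k * c ^ (p - 1)) := by
        gcongr
        exact sum_card_image_le (g := fun p => C ^ k * c ^ (p - 1)) fun p => by positivity
    _ = C ^ k * ∑ q ∈ Finset.range k, ((n : ℝ) * c) ^ q / (q + 1).factorial * ((q : ℝ) + 1) ^ k := by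
        rw [Finset.sum_range_succ']
        simp only [Nat.cast_zero, zero_pow hk, mul_zero, zero_mul, add_zero, Nat.add_sub_cancel]
        rw [Finset.mul_sum, Finset.mul_sum]
        refine Finset.sum_congr rfl fun q _ => ?_
        rw [pow_succ, mul_pow]
        push_cast
        field_simp
    _ ≤ C ^ k * ∑ q ∈ Finset.range k, G ^ q / (q + 1).factorial * ((q : ℝ) + 1) ^ k := by
        gcongr
    _ ≤ momentBound C G k := by
        rw [momentBound]
        gcongr
        exact (summable_momentBound_term hG0 k).sum_le_tsum _ fun q _ => by positivity

/-! ### Grouping closed walks by the pattern of their coincidences -/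

/-- Factorisations of a map as a surjection onto `Fin p` followed by an injection correspond to the
enumerations of its range. -/
noncomputable def factorizationEquiv {α β : Type*} (p : ℕ) (i : α → β) :
    {t : {φ : α → Fin p // Function.Surjective φ} × (Fin p ↪ β) // t.2 ∘ t.1.1 = i} ≃
      (Fin p ≃ Set.range i) where
  toFun t := (Equiv.ofInjective t.1.2 t.1.2.injective).trans (Equiv.setCongr
    ((t.1.1.2.range_comp t.1.2).symm.trans (congrArg Set.range t.2)))
  invFun σ := ⟨⟨⟨fun a => σ.symm ⟨i a, a, rfl⟩, fun q => by
    obtain ⟨a, ha⟩ := (σ q).2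
    exact ⟨a, by rw [Equiv.symm_apply_eq]; exact Subtype.ext ha⟩⟩,
    σ.toEmbedding.trans (Function.Embedding.subtype _)⟩, by ext; simp⟩
  left_inv t := by
    obtain ⟨⟨⟨φ, hφ⟩, e⟩, rfl⟩ := t
    refine Subtype.ext (Prod.ext (Subtype.ext (funext fun a => ?_)) ?_)
    · simp only
      rw [Equiv.symm_apply_eq]
      rfl
    · ext; rfl
  right_inv σ := by ext; rfl

/-- A sum over maps regrouped according to their factorisations through a surjection onto `Fin p`;
each map with `p` values has `p!` of them. -/
lemma sum_eq_sum_surjective {k n : ℕ} (h : (Fin k → Fin n) → ℂ) :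
    ∑ i, h i = ∑ p ∈ Finset.range (k + 1), ((p.factorial : ℂ))⁻¹ *
      ∑ t : {φ : Fin k → Fin p // Function.Surjective φ} × (Fin p ↪ Fin n), h (t.2 ∘ t.1.1) := by
  classical
  have hcard : ∀ (p : ℕ) (i : Fin k → Fin n),
      (Finset.univ.filter fun t : {φ : Fin k → Fin p // Function.Surjective φ} × (Fin p ↪ Fin n) =>
        t.2 ∘ t.1.1 = i).card = if (Finset.univ.image i).card = p then p.factorial else 0 :=
    fun p i => by
      rw [← Fintype.card_subtype, Fintype.card_congr (factorizationEquiv p i)]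
      have hr : Fintype.card (Set.range i) = (Finset.univ.image i).card := by
        rw [← Set.toFinset_card, Set.toFinset_range]
      split_ifs with hp
      · rw [Fintype.card_equiv (Fintype.equivOfCardEq (by rw [hr, hp, Fintype.card_fin])),
          Fintype.card_fin]
      · rw [Fintype.card_eq_zero_iff]
        exact ⟨fun σ => hp (by rw [← hr, ← Fintype.card_congr σ, Fintype.card_fin])⟩
  have h1 : ∀ p, ∑ t : {φ : Fin k → Fin p // Function.Surjective φ} × (Fin p ↪ Fin n),
      h (t.2 ∘ t.1.1) = ∑ i, (if (Finset.univ.image i).card = p then (p.factorial : ℂ) else 0) * h i :=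
    fun p => by
      rw [← Finset.sum_fiberwise_of_maps_to (s := Finset.univ) (t := Finset.univ)
        (g := fun t : {φ : Fin k → Fin p // Function.Surjective φ} × (Fin p ↪ Fin n) =>
          (t.2 : Fin p → Fin n) ∘ t.1.1) (fun _ _ => Finset.mem_univ _)]
      refine Finset.sum_congr rfl fun i _ => ?_
      rw [Finset.sum_congr rfl (g := fun _ => h i) fun t ht => by rw [(Finset.mem_filter.1 ht).2],
        Finset.sum_const, nsmul_eq_mul, hcard]
      push_cast
      rfl
  simp_rw [h1, Finset.mul_sum]
  rw [Finset.sum_comm]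
  refine Finset.sum_congr rfl fun i _ => ?_
  have hmem : (Finset.univ.image i).card ∈ Finset.range (k + 1) := by
    rw [Finset.mem_range, Nat.lt_succ_iff]
    exact Finset.card_image_le.trans (by simp)
  rw [Finset.sum_eq_single_of_mem _ hmem fun p _ hp => by simp [hp.symm]]
  have : ((Finset.univ.image i).card.factorial : ℂ) ≠ 0 := by
    exact_mod_cast Nat.factorial_ne_zero _
  simp [this]

/-- Distinct points of an independent sample form an independent sample. -/
lemma map_pi_comp_embedding {E ι κ : Type*} [Fintype ι] [Fintype κ] [MeasurableSpace E]
    (μ : Measure E) [IsProbabilityMeasure μ] (e : κ ↪ ι) :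
    (Measure.pi fun _ : ι => μ).map (fun x => x ∘ e) = Measure.pi fun _ : κ => μ := by
  have h1 : iIndepFun (fun (i : ι) (x : ι → E) => x i) (Measure.pi fun _ : ι => μ) :=
    iIndepFun_pi (X := fun _ x => x) fun _ => aemeasurable_id
  have h2 := (h1.precomp e.injective).map_fun_eq_pi_map
    fun _ => (measurable_pi_apply _).aemeasurable
  have h3 : ∀ a, (Measure.pi fun _ : ι => μ).map (fun x => x (e a)) = μ := fun a =>
    (measurePreserving_eval (fun _ : ι => μ) (e a)).map_eq
  simp_rw [h3] at h2
  exact h2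

/-- The mean moment as a sum over surjections, each counted with the number `n (n-1) ⋯ (n-q)` of
injections of its values into the `n` points. -/
lemma meanMoment_eq_sum_surjective (hf : Measurable f) (hC : ∀ x, ‖f x‖ ≤ C)
    (μ : Measure (Fin d → ℝ)) [IsProbabilityMeasure μ] (n : ℕ) {k : ℕ} (hk : k ≠ 0) :
    meanMoment f μ n k = ∑ q ∈ Finset.range k,
      ((n : ℂ)⁻¹ * n.descFactorial (q + 1)) * (((q + 1).factorial : ℂ))⁻¹ *
        ∑ φ : {φ : Fin k → Fin (q + 1) // Function.Surjective φ},
          ∫ x, walkProduct f φ.1 x ∂(Measure.pi fun _ : Fin (q + 1) => μ) := by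
  rw [meanMoment_eq_sum hf hC μ n hk, sum_eq_sum_surjective, Finset.sum_range_succ', mul_add]
  have h0 : IsEmpty {φ : Fin k → Fin 0 // Function.Surjective φ} :=
    ⟨fun φ => (φ.1 ⟨0, Nat.pos_of_ne_zero hk⟩).elim0⟩
  rw [Finset.univ_eq_empty (α := {φ : Fin k → Fin 0 // Function.Surjective φ} × (Fin 0 ↪ Fin n)),
    Finset.sum_empty, mul_zero, mul_zero, add_zero, Finset.mul_sum]
  refine Finset.sum_congr rfl fun q _ => ?_
  have h1 : ∀ t : {φ : Fin k → Fin (q + 1) // Function.Surjective φ} × (Fin (q + 1) ↪ Fin n),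
      ∫ x, walkProduct f (t.2 ∘ t.1.1) x ∂(Measure.pi fun _ : Fin n => μ) =
        ∫ x, walkProduct f t.1.1 x ∂(Measure.pi fun _ : Fin (q + 1) => μ) := fun t => by
    rw [← map_pi_comp_embedding μ t.2, integral_map]
    · rfl
    · exact (measurable_pi_lambda _ fun _ => measurable_pi_apply _).aemeasurable
    · exact (measurable_walkProduct hf _).aestronglyMeasurable
  simp_rw [h1]
  rw [Fintype.sum_prod_type]
  simp only [Finset.sum_const, Finset.card_univ, Fintype.card_embedding_eq, Fintype.card_fin,
    nsmul_eq_mul]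
  rw [← Finset.mul_sum]
  ring

end Moments

/-! ### The limit of the mean moments -/

lemma norm_le_of_mem_centredCube {d : ℕ} {x : Fin d → ℝ} (hx : x ∈ centredCube d 1) : ‖x‖ ≤ 1 := by
  refine (pi_norm_le_iff_of_nonneg zero_le_one).2 fun i => ?_
  have h1 := hx.1 i
  have h2 := hx.2 i
  rw [Real.norm_eq_abs, abs_le]
  constructor <;> linarith

section Limit

variable {d : ℕ} {f : (Fin d → ℝ) → ℂ} {C : ℝ}

lemma cycleProduct_eq_walkProduct {m q : ℕ} (φ : Fin m → Fin (q + 1)) (y : Fin q → Fin d → ℝ) :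
    cycleProduct f φ y = walkProduct f φ (Fin.cons 0 y : Fin (q + 1) → Fin d → ℝ) := rfl

lemma measurable_cycleProduct (hf : Measurable f) {m q : ℕ} (φ : Fin m → Fin (q + 1)) :
    Measurable (cycleProduct f φ) := by
  refine (measurable_walkProduct hf φ).comp (measurable_pi_lambda _ fun i => ?_)
  refine Fin.cases ?_ (fun j => ?_) i
  · simp
  · simpa using measurable_pi_apply j

/-- A cycle through all the points keeps them within bounded distance of the root. -/
lemma support_cycleProduct_subset (hsupp : Function.support f ⊆ centredCube d 1) {m q : ℕ}
    {φ : Fin m → Fin (q + 1)} (hφ : Function.Surjective φ) :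
    Function.support (cycleProduct f φ) ⊆ Metric.closedBall 0 (2 * m) := by
  intro y hy
  set x : Fin (q + 1) → Fin d → ℝ := Fin.cons 0 y with hx
  obtain ⟨j₀, hj₀⟩ := hφ 0
  have hm : m ≠ 0 := fun h => by subst h; exact j₀.elim0
  obtain ⟨m, rfl⟩ := Nat.exists_eq_succ_of_ne_zero hm
  have hstep : ∀ j : Fin (m + 1), ‖x (φ j) - x (φ (finRotate (m + 1) j))‖ ≤ 1 := fun j =>
    norm_le_of_mem_centredCube (hsupp fun h0 => hy (Finset.prod_eq_zero (Finset.mem_univ j) h0))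
  have hdist : ∀ j : Fin (m + 1), ‖x (φ j) - x (φ 0)‖ ≤ (j : ℕ) := by
    refine Fin.induction ?_ fun j ih => ?_
    · simp
    · have h1 := hstep j.castSucc
      rw [finRotate_castSucc, norm_sub_rev] at h1
      have h2 := norm_add_le (x (φ j.succ) - x (φ j.castSucc)) (x (φ j.castSucc) - x (φ 0))
      rw [sub_add_sub_cancel] at h2
      rw [Fin.val_succ]
      rw [Fin.val_castSucc] at ih
      push_cast
      linarith
  have hle : ∀ j : Fin (m + 1), ((j : ℕ) : ℝ) ≤ (m + 1 : ℕ) := fun j => by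
    exact_mod_cast j.2.le
  rw [mem_closedBall_zero_iff, pi_norm_le_iff_of_nonneg (by positivity)]
  intro i
  obtain ⟨j, hj⟩ := hφ i.succ
  have h1 : y i = (x (φ j) - x (φ 0)) - (x (φ j₀) - x (φ 0)) := by
    rw [hj, hj₀, hx]; simp
  rw [h1]
  refine (norm_sub_le _ _).trans ?_
  linarith [hdist j, hdist j₀, hle j, hle j₀]

/-- The integrand is bounded and vanishes off a ball. -/
theorem integrable_cycleProduct (hf : Measurable f) (hsupp : Function.support f ⊆ centredCube d 1)
    (hC : ∀ x, ‖f x‖ ≤ C) {m q : ℕ} {φ : Fin m → Fin (q + 1)} (hφ : Function.Surjective φ) :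
    Integrable (cycleProduct f φ) := by
  rw [← integrableOn_iff_integrable_of_support_subset (support_cycleProduct_subset hsupp hφ)]
  exact Measure.integrableOn_of_bounded (M := C ^ m) measure_closedBall_lt_top.ne
    (measurable_cycleProduct hf φ).aestronglyMeasurable
    (ae_of_all _ fun y => norm_walkProduct_le hC φ _)

lemma pi_cubeLaw_eq (d q : ℕ) {r : ℝ} (hr : 0 < r) :
    (Measure.pi fun _ : Fin q => cubeLaw d r) = ENNReal.ofReal (r⁻¹ ^ d) ^ q •
      (volume : Measure (Fin q → Fin d → ℝ)).restrict (Set.univ.pi fun _ => centredCube d r) := by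
  have := isProbabilityMeasure_cubeLaw d hr
  refine Measure.pi_eq fun s hs => ?_
  rw [Measure.smul_apply, Measure.restrict_apply (MeasurableSet.univ_pi hs), ← Set.pi_inter_distrib,
    volume_pi_pi, smul_eq_mul]
  simp_rw [cubeLaw_eq d hr, Measure.smul_apply, Measure.restrict_apply (hs _), smul_eq_mul]
  rw [Finset.prod_mul_distrib]
  simp

lemma walkProduct_cons_add {m q : ℕ} (φ : Fin m → Fin (q + 1)) (u : Fin d → ℝ)
    (y : Fin q → Fin d → ℝ) :
    walkProduct f φ (Fin.cons u (y + fun _ => u) : Fin (q + 1) → Fin d → ℝ) =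
      cycleProduct f φ y := by
  have h : ∀ i, (Fin.cons u (y + fun _ => u) : Fin (q + 1) → Fin d → ℝ) i =
      (Fin.cons 0 y : Fin (q + 1) → Fin d → ℝ) i + u := fun i =>
    Fin.cases (by simp) (fun j => by simp) i
  rw [cycleProduct_eq_walkProduct]
  simp only [walkProduct, h, add_sub_add_right_eq_sub]

/-- The event that the translates of `u` by the entries of `y` remain in the cube. -/
def cubeEvent (d q : ℕ) (r : ℝ) : Set ((Fin d → ℝ) × (Fin q → Fin d → ℝ)) :=
  {p | ∀ i, p.2 i + p.1 ∈ centredCube d r}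

lemma measurableSet_cubeEvent (d q : ℕ) (r : ℝ) : MeasurableSet (cubeEvent d q r) := by
  have : cubeEvent d q r = ⋂ i, {p | p.2 i + p.1 ∈ centredCube d r} := by
    ext; simp [cubeEvent]
  rw [this]
  refine MeasurableSet.iInter fun i => ?_
  have h : Measurable fun p : (Fin d → ℝ) × (Fin q → Fin d → ℝ) => p.2 i + p.1 :=
    ((measurable_pi_apply i).comp measurable_snd).add measurable_fst
  exact h (measurableSet_centredCube d r)

lemma integrable_cubeEvent_cycleProduct (hf : Measurable f)
    (hsupp : Function.support f ⊆ centredCube d 1) (hC : ∀ x, ‖f x‖ ≤ C) {m q : ℕ}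
    {φ : Fin m → Fin (q + 1)} (hφ : Function.Surjective φ) {r : ℝ} (hr : 0 < r) :
    Integrable (fun p : (Fin d → ℝ) × (Fin q → Fin d → ℝ) =>
      (cubeEvent d q r).indicator (fun p => cycleProduct f φ p.2) p)
      ((cubeLaw d r).prod volume) := by
  have := isProbabilityMeasure_cubeLaw d hr
  exact ((integrable_cycleProduct hf hsupp hC hφ).comp_snd (cubeLaw d r)).indicator
    (measurableSet_cubeEvent d q r)

/-- Rooting a cycle at the point with index `0`: up to the normalisation, the expectation of the product along
a cycle differs from the integral over the whole space by the boundary effect of the cube only. -/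
lemma pow_mul_integral_walkProduct (hf : Measurable f)
    (hsupp : Function.support f ⊆ centredCube d 1) (hC : ∀ x, ‖f x‖ ≤ C) {m q : ℕ}
    {φ : Fin m → Fin (q + 1)} (hφ : Function.Surjective φ) {r : ℝ} (hr : 0 < r) :
    (((r ^ d) ^ q : ℝ) : ℂ) * ∫ x, walkProduct f φ x ∂(Measure.pi fun _ => cubeLaw d r) =
      ∫ y, ∫ u, (cubeEvent d q r).indicator (fun p => cycleProduct f φ p.2) (u, y)
        ∂(cubeLaw d r) := by
  have := isProbabilityMeasure_cubeLaw d hr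
  have hmp := (measurePreserving_piFinSuccAbove (fun _ : Fin (q + 1) => cubeLaw d r) 0).symm
  let e := (MeasurableEquiv.piFinSuccAbove (fun _ : Fin (q + 1) => Fin d → ℝ) 0).symm
  have he : ∀ x y, e (x, y) = (Fin.cons x y : Fin (q + 1) → Fin d → ℝ) := fun x y =>
    Fin.insertNth_zero' x y
  have h1 : ∫ x, walkProduct f φ x ∂(Measure.pi fun _ => cubeLaw d r) =
      ∫ u, ∫ y, walkProduct f φ (Fin.cons u y : Fin (q + 1) → Fin d → ℝ)
        ∂(Measure.pi fun _ => cubeLaw d r) ∂(cubeLaw d r) := by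
    rw [← hmp.integral_comp' (g := walkProduct f φ)]
    refine (integral_prod _ ?_).trans ?_
    · exact (hmp.integrable_comp_emb e.measurableEmbedding).2 (integrable_walkProduct hf hC _ φ)
    · exact integral_congr_ae (ae_of_all _ fun u => integral_congr_ae (ae_of_all _ fun y =>
        congrArg (walkProduct f φ) (he u y)))
  have h2 : ∀ u, ∫ y, walkProduct f φ (Fin.cons u y : Fin (q + 1) → Fin d → ℝ)
      ∂(Measure.pi fun _ => cubeLaw d r) = (((r ^ d) ^ q : ℝ) : ℂ)⁻¹ *
        ∫ y, (cubeEvent d q r).indicator (fun p => cycleProduct f φ p.2) (u, y) := fun u => by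
    have hm : MeasurableSet (Set.univ.pi fun _ : Fin q => centredCube d r) :=
      MeasurableSet.univ_pi fun _ => measurableSet_centredCube d r
    rw [pi_cubeLaw_eq d q hr, integral_smul_measure, ← integral_indicator hm,
      ← integral_add_right_eq_self _ (fun _ => u : Fin q → Fin d → ℝ), ENNReal.toReal_pow,
      ENNReal.toReal_ofReal (by positivity), Complex.real_smul]
    congr 1
    · push_cast
      rw [inv_pow, inv_pow]
    · refine integral_congr_ae (ae_of_all _ fun y => ?_)
      have hiff : (y + fun _ => u) ∈ (Set.univ.pi fun _ : Fin q => centredCube d r) ↔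
          (u, y) ∈ cubeEvent d q r := by simp [cubeEvent]
      beta_reduce
      by_cases h : (u, y) ∈ cubeEvent d q r
      · rw [Set.indicator_of_mem h, Set.indicator_of_mem (hiff.2 h)]
        exact walkProduct_cons_add φ u y
      · rw [Set.indicator_of_notMem h, Set.indicator_of_notMem (mt hiff.1 h)]
  rw [h1]
  simp_rw [h2]
  rw [integral_const_mul, mul_inv_cancel_left₀ (by exact_mod_cast (by positivity))]
  exact integral_integral_swap (integrable_cubeEvent_cycleProduct hf hsupp hC hφ hr)

lemma cubeLaw_real_centredCube (d : ℕ) {r s : ℝ} (hr : 0 < r) (hs : 0 ≤ s) (hsr : s ≤ r) :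
    (cubeLaw d r).real (centredCube d s) = (s / r) ^ d := by
  have hsub : centredCube d s ⊆ centredCube d r :=
    Set.Icc_subset_Icc (fun _ => by linarith) (fun _ => by linarith)
  rw [Measure.real, cubeLaw_eq d hr, Measure.smul_apply,
    Measure.restrict_apply (measurableSet_centredCube d s), Set.inter_eq_left.2 hsub,
    volume_centredCube, smul_eq_mul, ENNReal.toReal_mul, ENNReal.toReal_pow,
    ENNReal.toReal_ofReal (by positivity), ENNReal.toReal_ofReal hs, ← mul_pow]
  congr 1
  field_simp

/-- The boundary effect disappears as the cube grows. -/
lemma tendsto_cubeLaw_cubeEvent (d q : ℕ) (y : Fin q → Fin d → ℝ) :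
    Tendsto (fun r => (cubeLaw d r).real {u | (u, y) ∈ cubeEvent d q r}) atTop (𝓝 1) := by
  have hlow : Tendsto (fun r : ℝ => ((r - 2 * ‖y‖) / r) ^ d) atTop (𝓝 1) := by
    have h1 : Tendsto (fun r : ℝ => 1 - 2 * ‖y‖ / r) atTop (𝓝 (1 - 0)) :=
      tendsto_const_nhds.sub (tendsto_const_nhds.div_atTop tendsto_id)
    have h2 := h1.pow d
    rw [sub_zero, one_pow] at h2
    refine h2.congr' ?_
    filter_upwards [eventually_gt_atTop 0] with r hr
    rw [sub_div, div_self hr.ne']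
  refine tendsto_of_tendsto_of_tendsto_of_le_of_le' hlow tendsto_const_nhds ?_ ?_
  · filter_upwards [eventually_gt_atTop 0, eventually_ge_atTop (2 * ‖y‖)] with r hr hry
    have := isProbabilityMeasure_cubeLaw d hr
    rw [← cubeLaw_real_centredCube d hr (by linarith : 0 ≤ r - 2 * ‖y‖)
      (by linarith [norm_nonneg y])]
    refine measureReal_mono fun u hu i => ?_
    have hy : ∀ j, |y i j| ≤ ‖y‖ := fun j => (norm_le_pi_norm (y i) j).trans (norm_le_pi_norm y i)
    constructor <;> intro j <;> have h1 := hu.1 j <;> have h2 := hu.2 j <;>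
      have h3 := abs_le.1 (hy j) <;> simp only [Pi.add_apply] <;> linarith [h3.1, h3.2]
  · filter_upwards [eventually_gt_atTop 0] with r hr
    have := isProbabilityMeasure_cubeLaw d hr
    exact measureReal_le_one

/-- In the limit of large cubes, the rescaled expectation of the product along a cycle is the integral
of the rooted product over the whole space. -/
theorem tendsto_pow_mul_integral_walkProduct (hf : Measurable f)
    (hsupp : Function.support f ⊆ centredCube d 1) (hC : ∀ x, ‖f x‖ ≤ C) {m q : ℕ}
    {φ : Fin m → Fin (q + 1)} (hφ : Function.Surjective φ) :
    Tendsto (fun r : ℝ => (((r ^ d) ^ q : ℝ) : ℂ) *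
      ∫ x, walkProduct f φ x ∂(Measure.pi fun _ => cubeLaw d r)) atTop
      (𝓝 (∫ y, cycleProduct f φ y)) := by
  have hinner : ∀ r y, ∫ u, (cubeEvent d q r).indicator (fun p => cycleProduct f φ p.2) (u, y)
      ∂(cubeLaw d r) =
        (cubeLaw d r).real {u | (u, y) ∈ cubeEvent d q r} • cycleProduct f φ y := fun r y => by
    have hms : MeasurableSet {u | (u, y) ∈ cubeEvent d q r} :=
      measurable_prodMk_right (measurableSet_cubeEvent d q r)
    rw [← setIntegral_const, ← integral_indicator hms]
    rfl
  have h : Tendsto (fun r : ℝ => ∫ y, ∫ u,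
      (cubeEvent d q r).indicator (fun p => cycleProduct f φ p.2) (u, y) ∂(cubeLaw d r)) atTop
      (𝓝 (∫ y, cycleProduct f φ y)) := by
    refine tendsto_integral_filter_of_dominated_convergence (fun y => ‖cycleProduct f φ y‖) ?_ ?_
      (integrable_cycleProduct hf hsupp hC hφ).norm (ae_of_all _ fun y => ?_)
    · filter_upwards [eventually_gt_atTop 0] with r hr
      have := isProbabilityMeasure_cubeLaw d hr
      exact (integrable_cubeEvent_cycleProduct hf hsupp hC hφ
        hr).integral_prod_right.aestronglyMeasurable
    · filter_upwards [eventually_gt_atTop 0] with r hr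
      have := isProbabilityMeasure_cubeLaw d hr
      refine ae_of_all _ fun y => ?_
      rw [hinner, norm_smul, Real.norm_of_nonneg measureReal_nonneg]
      exact mul_le_of_le_one_left (norm_nonneg _) measureReal_le_one
    · simp_rw [hinner]
      simpa using (tendsto_cubeLaw_cubeEvent d q y).smul_const (cycleProduct f φ y)
  refine h.congr' ?_
  filter_upwards [eventually_gt_atTop 0] with r hr
  exact (pow_mul_integral_walkProduct hf hsupp hC hφ hr).symm

lemma tendsto_descFactorial_mul_pow (hd : 1 ≤ d) {δ : ℕ → ℝ} {γ : ℝ}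
    (hδ0 : Tendsto δ atTop (𝓝 0)) (hδ : Tendsto (fun n : ℕ => (n : ℝ) * δ n ^ d) atTop (𝓝 γ))
    (q : ℕ) : Tendsto (fun n : ℕ => (n : ℝ)⁻¹ * n.descFactorial (q + 1) * (δ n ^ d) ^ q) atTop
      (𝓝 (γ ^ q)) := by
  induction q with
  | zero =>
    refine Tendsto.congr' ?_ tendsto_const_nhds
    filter_upwards [eventually_ne_atTop 0] with n hn
    have : (n : ℝ) ≠ 0 := by exact_mod_cast hn
    simp [this]
  | succ q ih =>
    have h1 : Tendsto (fun n : ℕ => (n : ℝ) * δ n ^ d - (q + 1) * δ n ^ d) atTop (𝓝 γ) := by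
      have h2 := (hδ0.pow d).const_mul ((q : ℝ) + 1)
      rw [zero_pow (by omega), mul_zero] at h2
      simpa using hδ.sub h2
    rw [pow_succ]
    refine (ih.mul h1).congr' ?_
    filter_upwards [eventually_ge_atTop (q + 1)] with n hn
    rw [Nat.descFactorial_succ n (q + 1)]
    push_cast [Nat.cast_sub hn]
    ring

/-- The term `f 0 ^ k` of the limit moment is the contribution of the only surjection onto one point. -/
lemma limitMoment_eq_sum_range {γ : ℝ} {k : ℕ} (hk : k ≠ 0) :
    limitMoment f γ k = ∑ q ∈ Finset.range k, (γ : ℂ) ^ q * (((q + 1).factorial : ℂ))⁻¹ *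
      ∑ φ : {φ : Fin k → Fin (q + 1) // Function.Surjective φ}, ∫ y, cycleProduct f φ.1 y := by
  classical
  have : Subsingleton (Fin (0 + 1)) := inferInstanceAs (Subsingleton (Fin 1))
  rw [Finset.range_eq_Ico, Finset.sum_eq_sum_Ico_succ_bot (Nat.pos_of_ne_zero hk), limitMoment]
  congr 1
  · have huniq : ∀ φ : {φ : Fin k → Fin (0 + 1) // Function.Surjective φ},
        ∫ y, cycleProduct f φ.1 y = f 0 ^ k := fun φ => by
      have h : ∀ y, cycleProduct f φ.1 y = f 0 ^ k := fun y => by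
        have h0 : ∀ i : Fin (0 + 1), (Fin.cons 0 y : Fin (0 + 1) → Fin d → ℝ) i = 0 := fun i => by
          rw [Subsingleton.elim i 0, Fin.cons_zero]
        simp only [cycleProduct, h0, sub_self, Finset.prod_const, Finset.card_univ,
          Fintype.card_fin]
      simp_rw [h]
      rw [integral_const]
      simp [Measure.real, volume_pi]
    have : Unique {φ : Fin k → Fin (0 + 1) // Function.Surjective φ} :=
      { default := ⟨fun _ => 0, fun i => ⟨⟨0, Nat.pos_of_ne_zero hk⟩, Subsingleton.elim _ _⟩⟩
        uniq := fun φ => Subtype.ext (funext fun _ => Subsingleton.elim _ _) }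
    simp_rw [huniq]
    simp
  · refine Finset.sum_congr rfl fun q _ => ?_
    rw [div_eq_mul_inv]
    congr 1
    refine Finset.sum_subtype _ (fun φ => ?_) _
    simp

/-- The mean moments of the empirical spectral measures converge to the limit moments. -/
theorem tendsto_meanMoment (hd : 1 ≤ d) (hf : Measurable f)
    (hsupp : Function.support f ⊆ centredCube d 1) (hC : ∀ x, ‖f x‖ ≤ C) {δ : ℕ → ℝ} {γ : ℝ}
    (hpos : ∀ n, 0 < δ n) (hδ0 : Tendsto δ atTop (𝓝 0))
    (hδ : Tendsto (fun n : ℕ => (n : ℝ) * δ n ^ d) atTop (𝓝 γ)) (k : ℕ) :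
    Tendsto (fun n => meanMoment f (cubeLaw d (δ n)⁻¹) n k) atTop (𝓝 (limitMoment f γ k)) := by
  have hprob : ∀ n, IsProbabilityMeasure (cubeLaw d (δ n)⁻¹) := fun n =>
    isProbabilityMeasure_cubeLaw d (inv_pos.2 (hpos n))
  rcases eq_or_ne k 0 with rfl | hk
  · have h0 : limitMoment f γ 0 = 1 := by simp [limitMoment]
    rw [h0]
    refine Tendsto.congr' ?_ tendsto_const_nhds
    filter_upwards [eventually_ne_atTop 0] with n hn
    exact (meanMoment_zero _ hn).symm
  rw [limitMoment_eq_sum_range hk]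
  have hinv : Tendsto (fun n => (δ n)⁻¹) atTop atTop :=
    (tendsto_nhdsWithin_iff.2 ⟨hδ0, Eventually.of_forall hpos⟩).inv_tendsto_nhdsGT_zero
  have hlim : Tendsto (fun n : ℕ => ∑ q ∈ Finset.range k,
      (((n : ℝ)⁻¹ * n.descFactorial (q + 1) * (δ n ^ d) ^ q : ℝ) : ℂ) *
        (((q + 1).factorial : ℂ))⁻¹ *
        ∑ φ : {φ : Fin k → Fin (q + 1) // Function.Surjective φ},
          (((((δ n)⁻¹) ^ d) ^ q : ℝ) : ℂ) *
            ∫ x, walkProduct f φ.1 x ∂(Measure.pi fun _ => cubeLaw d (δ n)⁻¹)) atTop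
      (𝓝 (∑ q ∈ Finset.range k, (γ : ℂ) ^ q * (((q + 1).factorial : ℂ))⁻¹ *
      ∑ φ : {φ : Fin k → Fin (q + 1) // Function.Surjective φ}, ∫ y, cycleProduct f φ.1 y)) := by
    refine tendsto_finsetSum _ fun q _ => Tendsto.mul (Tendsto.mul_const _ ?_)
      (tendsto_finsetSum _ fun φ _ => ?_)
    · have := (Complex.continuous_ofReal.tendsto _).comp
        (tendsto_descFactorial_mul_pow hd hδ0 hδ q)
      rw [Complex.ofReal_pow] at this
      exact this
    · exact (tendsto_pow_mul_integral_walkProduct hf hsupp hC φ.2).comp hinv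
  refine hlim.congr fun n => ?_
  rw [meanMoment_eq_sum_surjective hf hC _ n hk]
  refine Finset.sum_congr rfl fun q _ => ?_
  rw [← Finset.mul_sum]
  have h0 : (δ n : ℂ) ≠ 0 := by exact_mod_cast (hpos n).ne'
  have h1 : ((δ n : ℂ) ^ d) ^ q * (((δ n : ℂ)⁻¹) ^ d) ^ q = 1 := by
    rw [← mul_pow, ← mul_pow, mul_inv_cancel₀ h0, one_pow, one_pow]
  push_cast
  linear_combination (((n : ℂ))⁻¹ * n.descFactorial (q + 1) * (((q + 1).factorial : ℂ))⁻¹ *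
    ∑ φ : {φ : Fin k → Fin (q + 1) // Function.Surjective φ},
      ∫ x, walkProduct f φ.1 x ∂(Measure.pi fun _ => cubeLaw d (δ n)⁻¹)) * h1

end Limit

/-! ### The mean spectral measure -/

lemma integral_empiricalSpectralMeasure {n : ℕ} {A : Matrix (Fin n) (Fin n) ℂ} (hA : A.IsHermitian)
    {F : Type*} [NormedAddCommGroup F] [NormedSpace ℝ F] [CompleteSpace F] (g : ℝ → F) :
    ∫ t, g t ∂(empiricalSpectralMeasure hA : Measure ℝ) =
      (n : ℝ)⁻¹ • ∑ i, g (hA.eigenvalues i) := by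
  rw [empiricalSpectralMeasure, FiniteMeasure.toMeasure_mk, integral_smul_nnreal_measure,
    integral_finsetSum_measure fun i _ => integrable_dirac (by simp)]
  simp only [integral_dirac]
  rw [NNReal.smul_def]
  simp

lemma isProbabilityMeasure_empiricalSpectralMeasure {n : ℕ} (hn : n ≠ 0)
    {A : Matrix (Fin n) (Fin n) ℂ} (hA : A.IsHermitian) :
    IsProbabilityMeasure (empiricalSpectralMeasure hA : Measure ℝ) := by
  have hn' : (n : ENNReal) ≠ 0 := by exact_mod_cast hn
  have hn0 : (n : NNReal) ≠ 0 := by exact_mod_cast hn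
  refine ⟨?_⟩
  rw [empiricalSpectralMeasure, FiniteMeasure.toMeasure_mk]
  simp only [Measure.smul_apply, Measure.finsetSum_apply, measure_univ, Finset.sum_const,
    Finset.card_univ, Fintype.card_fin, nsmul_eq_mul, mul_one]
  rw [ENNReal.smul_def, smul_eq_mul, ENNReal.coe_inv hn0]
  simpa using ENNReal.inv_mul_cancel hn' (ENNReal.natCast_ne_top n)

lemma norm_trace_pow_le {n : ℕ} {A : Matrix (Fin n) (Fin n) ℂ} {C : ℝ} (hC : ∀ i j, ‖A i j‖ ≤ C)
    {k : ℕ} (hk : k ≠ 0) : ‖(A ^ k).trace‖ ≤ (n * C) ^ k := by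
  rw [trace_pow_eq_sum_cycles A hk, mul_pow]
  refine (norm_sum_le_of_le (f := fun i : Fin k → Fin n => ∏ j, A (i j) (i (finRotate k j)))
    (n := fun _ => C ^ k) _ fun i _ => ?_).trans (by simp)
  rw [norm_prod]
  calc _ ≤ ∏ _j : Fin k, C := Finset.prod_le_prod (fun _ _ => norm_nonneg _) fun _ _ => hC _ _
    _ = C ^ k := by simp

lemma abs_eigenvalues_le {n : ℕ} {A : Matrix (Fin n) (Fin n) ℂ} (hA : A.IsHermitian) {C : ℝ}
    (hC : ∀ i j, ‖A i j‖ ≤ C) (i : Fin n) : |hA.eigenvalues i| ≤ n * C := by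
  have h0 : 0 ≤ C := (norm_nonneg _).trans (hC i i)
  have h1 := norm_trace_pow_le hC two_ne_zero
  rw [trace_pow_eq_sum_eigenvalues hA, ← Complex.ofReal_sum, Complex.norm_real,
    Real.norm_of_nonneg (Finset.sum_nonneg fun _ _ => sq_nonneg _)] at h1
  refine abs_le_of_sq_le_sq (le_trans ?_ h1) (by positivity)
  exact Finset.single_le_sum (f := fun i => hA.eigenvalues i ^ 2) (fun _ _ => sq_nonneg _)
    (Finset.mem_univ i)

section Mean

variable {d : ℕ} {f : (Fin d → ℝ) → ℂ}

lemma measurable_euclideanMatrix_apply (hfm : Measurable f) {n : ℕ} (i j : Fin n) :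
    Measurable fun x : Fin n → Fin d → ℝ => euclideanMatrix f x i j :=
  hfm.comp ((measurable_pi_apply i).sub (measurable_pi_apply j))

/-- The linear spectral statistic `n⁻¹ ∑ᵢ g(λᵢ)` of the Euclidean matrix of `x`. -/
noncomputable def spectralStat (hf : IsHermitianFun f) (g : ℝ → ℝ) {n : ℕ}
    (x : Fin n → Fin d → ℝ) : ℝ :=
  (n : ℝ)⁻¹ * ∑ i, g ((euclideanMatrix_isHermitian hf x).eigenvalues i)

lemma measurable_spectralStat (hf : IsHermitianFun f) (hfm : Measurable f) {g : ℝ → ℝ}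
    (hg : Continuous g) (n : ℕ) : Measurable (spectralStat hf g (n := n)) :=
  (measurable_sum_eigenvalues _ (measurable_euclideanMatrix_apply hfm) hg).const_mul _

lemma integral_eq_spectralStat (hf : IsHermitianFun f) (g : ℝ → ℝ) {n : ℕ}
    (x : Fin n → Fin d → ℝ) :
    ∫ t, g t ∂(empiricalSpectralMeasure (euclideanMatrix_isHermitian hf x) : Measure ℝ) =
      spectralStat hf g x := by
  rw [integral_empiricalSpectralMeasure, spectralStat, smul_eq_mul]

/-- Half-lines generate the Borel sets, and their measures are limits of integrals against ramps. -/
lemma measurable_empiricalSpectralMeasure (hf : IsHermitianFun f) (hfm : Measurable f) (n : ℕ) :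
    Measurable fun x : Fin (n + 1) → Fin d → ℝ =>
      (empiricalSpectralMeasure (euclideanMatrix_isHermitian hf x) : Measure ℝ) := by
  have hprob : ∀ x : Fin (n + 1) → Fin d → ℝ, IsProbabilityMeasure
      (empiricalSpectralMeasure (euclideanMatrix_isHermitian hf x) : Measure ℝ) := fun x =>
    isProbabilityMeasure_empiricalSpectralMeasure n.succ_ne_zero _
  refine Measurable.measure_of_isPiSystem_of_isProbabilityMeasure
    (BorelSpace.measurable_eq.trans Real.borel_eq_generateFrom_Ioi_rat) Real.isPiSystem_Ioi_rat
    fun s hs => ?_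
  obtain ⟨q, rfl⟩ : ∃ q : ℚ, s = Set.Ioi (q : ℝ) := by simpa [eq_comm] using hs
  have h : Measurable fun x : Fin (n + 1) → Fin d → ℝ =>
      (empiricalSpectralMeasure (euclideanMatrix_isHermitian hf x) : Measure ℝ).real
        (Set.Ioi (q : ℝ)) := by
    refine measurable_of_tendsto_metrizable (f := fun (k : ℕ) x => ((k : ℝ) + 1) *
      spectralStat hf (ramp (q : ℝ) ((q + 1 / ((k : ℚ) + 1) : ℚ) : ℝ)) x) (fun k =>
        (measurable_spectralStat hf hfm (continuous_ramp _ _) _).const_mul _)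
      (tendsto_pi_nhds.2 fun x => ?_)
    have := tendsto_integral_ramp_Ioi
      (empiricalSpectralMeasure (euclideanMatrix_isHermitian hf x) : Measure ℝ) q
    exact this.congr fun k => by rw [integral_eq_spectralStat hf (ramp _ _) x]
  have h2 : (fun x : Fin (n + 1) → Fin d → ℝ =>
      (empiricalSpectralMeasure (euclideanMatrix_isHermitian hf x) : Measure ℝ)
        (Set.Ioi (q : ℝ))) = fun x => ENNReal.ofReal
      ((empiricalSpectralMeasure (euclideanMatrix_isHermitian hf x) : Measure ℝ).real
        (Set.Ioi (q : ℝ))) := funext fun x => (ofReal_measureReal (measure_ne_top _ _)).symm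
  rw [h2]
  exact h.ennreal_ofReal

/-- The empirical spectral measure as a Markov kernel. -/
noncomputable def spectralKernel (hf : IsHermitianFun f) (hfm : Measurable f) (n : ℕ) :
    Kernel (Fin (n + 1) → Fin d → ℝ) ℝ where
  toFun x := (empiricalSpectralMeasure (euclideanMatrix_isHermitian hf x) : Measure ℝ)
  measurable' := measurable_empiricalSpectralMeasure hf hfm n

lemma spectralKernel_apply (hf : IsHermitianFun f) (hfm : Measurable f) (n : ℕ)
    (x : Fin (n + 1) → Fin d → ℝ) : spectralKernel hf hfm n x =
      (empiricalSpectralMeasure (euclideanMatrix_isHermitian hf x) : Measure ℝ) := rfl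

instance (hf : IsHermitianFun f) (hfm : Measurable f) (n : ℕ) :
    IsMarkovKernel (spectralKernel hf hfm n) :=
  ⟨fun _ => isProbabilityMeasure_empiricalSpectralMeasure n.succ_ne_zero _⟩

/-- The mean of the empirical spectral measure of the Euclidean matrix of `n + 1` independent points
with law `μ`. -/
noncomputable def meanSpectralMeasure (hf : IsHermitianFun f) (hfm : Measurable f)
    (μ : Measure (Fin d → ℝ)) (n : ℕ) : Measure ℝ :=
  (Measure.pi fun _ : Fin (n + 1) => μ).bind (spectralKernel hf hfm n)

instance (hf : IsHermitianFun f) (hfm : Measurable f) (μ : Measure (Fin d → ℝ))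
    [IsProbabilityMeasure μ] (n : ℕ) : IsProbabilityMeasure (meanSpectralMeasure hf hfm μ n) := by
  unfold meanSpectralMeasure; infer_instance

variable {C : ℝ} (hf : IsHermitianFun f) (hfm : Measurable f) (μ : Measure (Fin d → ℝ))

lemma ae_meanSpectralMeasure_abs_le (hC : ∀ x, ‖f x‖ ≤ C) (n : ℕ) :
    ∀ᵐ t ∂(meanSpectralMeasure hf hfm μ n), |t| ≤ (n + 1 : ℕ) * C := by
  refine Measure.ae_comp_of_ae_ae (measurableSet_le measurable_norm measurable_const)
    (ae_of_all _ fun x => ?_)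
  rw [spectralKernel_apply, empiricalSpectralMeasure, FiniteMeasure.toMeasure_mk]
  refine Measure.ae_smul_measure ?_ _
  rw [ae_finsetSum_measure_iff]
  intro i _
  exact (ae_dirac_iff (p := fun t : ℝ => |t| ≤ (n + 1 : ℕ) * C)
    (measurableSet_le measurable_norm measurable_const)).2
    (abs_eigenvalues_le (euclideanMatrix_isHermitian hf x) (fun _ _ => hC _) i)

variable [IsProbabilityMeasure μ]

lemma integrable_meanSpectralMeasure (hC : ∀ x, ‖f x‖ ≤ C) (n : ℕ) {F : Type*}
    [NormedAddCommGroup F] [NormedSpace ℝ F] [SecondCountableTopology F] {g : ℝ → F}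
    (hg : Continuous g) :
    Integrable g (meanSpectralMeasure hf hfm μ n) := by
  obtain ⟨B, hB⟩ := (isCompact_Icc (a := -((n + 1 : ℕ) * C)) (b := (n + 1 : ℕ) * C)).exists_bound_of_continuousOn
    hg.continuousOn
  refine (integrable_const B).mono' hg.aestronglyMeasurable ?_
  filter_upwards [ae_meanSpectralMeasure_abs_le hf hfm μ hC n] with t ht
  exact hB t (abs_le.1 ht)

lemma integral_meanSpectralMeasure (hC : ∀ x, ‖f x‖ ≤ C) (n : ℕ) {F : Type*}
    [NormedAddCommGroup F] [NormedSpace ℝ F] [CompleteSpace F] [SecondCountableTopology F]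
    {g : ℝ → F} (hg : Continuous g) :
    ∫ t, g t ∂(meanSpectralMeasure hf hfm μ n) = ∫ x, ((n + 1 : ℕ) : ℝ)⁻¹ •
      ∑ i, g ((euclideanMatrix_isHermitian hf x).eigenvalues i)
        ∂(Measure.pi fun _ : Fin (n + 1) => μ) := by
  have hi := integrable_meanSpectralMeasure hf hfm μ hC n hg
  rw [meanSpectralMeasure, Measure.comp_eq_comp_const_apply] at *
  rw [Kernel.integral_comp hi, Kernel.const_apply]
  refine integral_congr_ae (ae_of_all _ fun x => ?_)
  beta_reduce
  rw [spectralKernel_apply, integral_empiricalSpectralMeasure]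

lemma integral_pow_meanSpectralMeasure (hC : ∀ x, ‖f x‖ ≤ C) (n k : ℕ) :
    ((∫ t, t ^ k ∂(meanSpectralMeasure hf hfm μ n) : ℝ) : ℂ) = meanMoment f μ (n + 1) k := by
  rw [integral_meanSpectralMeasure hf hfm μ hC n (continuous_pow k), meanMoment,
    ← integral_complex_ofReal, ← integral_const_mul]
  refine integral_congr_ae (ae_of_all _ fun x => ?_)
  beta_reduce
  rw [trace_pow_eq_sum_eigenvalues (euclideanMatrix_isHermitian hf x)]
  push_cast
  simp

/-- The characteristic function of the mean spectral measure is the exponential generating function of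
the mean moments. -/
lemma charFun_meanSpectralMeasure (hC : ∀ x, ‖f x‖ ≤ C) (n : ℕ) (s : ℝ) :
    charFun (meanSpectralMeasure hf hfm μ n) s =
      ∑' k : ℕ, (s * Complex.I) ^ k / k.factorial * meanMoment f μ (n + 1) k := by
  have hC0 : 0 ≤ C := (norm_nonneg _).trans (hC 0)
  have hsum : HasSum (fun k : ℕ => ∫ t : ℝ, ((s : ℂ) * Complex.I) ^ k / k.factorial * ((t ^ k : ℝ) : ℂ)
      ∂(meanSpectralMeasure hf hfm μ n))
      (∫ t : ℝ, Complex.exp (s * t * Complex.I) ∂(meanSpectralMeasure hf hfm μ n)) := by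
    refine hasSum_integral_of_dominated_convergence
      (fun k _ => (|s| * ((n + 1 : ℕ) * C)) ^ k / k.factorial) (fun k => ?_) (fun k => ?_)
      (ae_of_all _ fun _ => Real.summable_pow_div_factorial _) (integrable_const _)
      (ae_of_all _ fun t => ?_)
    · exact (Continuous.aestronglyMeasurable (by fun_prop))
    · filter_upwards [ae_meanSpectralMeasure_abs_le hf hfm μ hC n] with t ht
      rw [norm_mul, norm_div, norm_pow, norm_mul, Complex.norm_I, mul_one, Complex.norm_real,
        Complex.norm_natCast, Complex.norm_real, norm_pow, Real.norm_eq_abs, Real.norm_eq_abs,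
        mul_pow, mul_div_right_comm]
      gcongr
    · have h := NormedSpace.expSeries_div_hasSum_exp ((s : ℂ) * t * Complex.I)
      rw [← Complex.exp_eq_exp_ℂ] at h
      have h' : ∀ k : ℕ, ((s : ℂ) * Complex.I) ^ k / k.factorial * ((t ^ k : ℝ) : ℂ) =
          ((s : ℂ) * t * Complex.I) ^ k / k.factorial := fun k => by
        push_cast
        rw [mul_right_comm (s : ℂ), mul_pow _ (t : ℂ)]
        ring
      simp_rw [h']
      exact h
  rw [charFun_apply_real, ← hsum.tsum_eq]
  refine tsum_congr fun k => ?_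
  rw [integral_const_mul, integral_complex_ofReal, integral_pow_meanSpectralMeasure hf hfm μ hC]

end Mean

/-! ### The limit law for bounded functions -/

section Bounded

variable {d : ℕ} {f : (Fin d → ℝ) → ℂ} {C : ℝ}

lemma cubeLaw_sub_mem_centredCube_le (d : ℕ) {δ : ℝ} (hδ : 0 < δ) (x : Fin d → ℝ) :
    cubeLaw d δ⁻¹ {y | x - y ∈ centredCube d 1} ≤ ENNReal.ofReal (δ ^ d) := by
  have h := cubeLaw_sub_mem_le d (inv_pos.2 hδ) (measurableSet_centredCube d 1) x
  simpa [volume_centredCube] using h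

/-- Side lengths realising the density `γ`. -/
lemma exists_scale {d : ℕ} (hd : 1 ≤ d) {γ : ℝ} (hγ : 0 < γ) :
    ∃ δ : ℕ → ℝ, (∀ n, 0 < δ n) ∧ Tendsto δ atTop (𝓝 0) ∧
      Tendsto (fun n : ℕ => (n : ℝ) * δ n ^ d) atTop (𝓝 γ) := by
  have hd0 : d ≠ 0 := by omega
  have hpow : ∀ n : ℕ, ((γ * (1 / ((n : ℝ) + 1))) ^ ((d : ℝ)⁻¹)) ^ d = γ * (1 / ((n : ℝ) + 1)) :=
    fun n => Real.rpow_inv_natCast_pow (by positivity) hd0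
  have h0 : Tendsto (fun n : ℕ => γ * (1 / ((n : ℝ) + 1))) atTop (𝓝 0) := by
    simpa using tendsto_one_div_add_atTop_nhds_zero_nat.const_mul γ
  refine ⟨fun n => (γ * (1 / ((n : ℝ) + 1))) ^ ((d : ℝ)⁻¹), fun n => by positivity, ?_, ?_⟩
  · have := h0.rpow_const (p := (d : ℝ)⁻¹) (Or.inr (by positivity))
    rwa [Real.zero_rpow (by positivity)] at this
  · simp_rw [hpow]
    have h1 : Tendsto (fun n : ℕ => γ - γ * (1 / ((n : ℝ) + 1))) atTop (𝓝 (γ - 0)) :=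
      tendsto_const_nhds.sub h0
    rw [sub_zero] at h1
    refine h1.congr fun n => ?_
    have : (n : ℝ) + 1 ≠ 0 := by positivity
    field_simp
    ring

/-- The exponential generating function of the limit moments, which is the characteristic function of
the limit law. -/
noncomputable def limitCharFun (f : (Fin d → ℝ) → ℂ) (γ s : ℝ) : ℂ :=
  ∑' k : ℕ, (s * Complex.I) ^ k / k.factorial * limitMoment f γ k

variable (hd : 1 ≤ d) (hfm : Measurable f) (hsupp : Function.support f ⊆ centredCube d 1)
  (hC : ∀ x, ‖f x‖ ≤ C)
include hd hfm hsupp hC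

/-- The bound for the mean moments passes to the limit. -/
lemma norm_limitMoment_le {γ G : ℝ} (hγ : 0 < γ) (hG : γ < G) (k : ℕ) :
    ‖limitMoment f γ k‖ ≤ momentBound C G k := by
  obtain ⟨δ, hpos, hδ0, hδ⟩ := exists_scale hd hγ
  refine le_of_tendsto (tendsto_meanMoment hd hfm hsupp hC hpos hδ0 hδ k).norm ?_
  filter_upwards [hδ.eventually (gt_mem_nhds hG)] with n hn
  have := isProbabilityMeasure_cubeLaw d (inv_pos.2 (hpos n))
  exact norm_meanMoment_le hfm hsupp hC _ (pow_nonneg (hpos n).le d)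
    (cubeLaw_sub_mem_centredCube_le d (hpos n)) hn.le k

lemma norm_limitCharFun_term_le {γ G s S : ℝ} (hγ : 0 < γ) (hG : γ < G) (hs : |s| ≤ S) (k : ℕ) :
    ‖((s : ℂ) * Complex.I) ^ k / k.factorial * limitMoment f γ k‖ ≤
      S ^ k / k.factorial * momentBound C G k := by
  rw [norm_mul, norm_div, norm_pow, norm_mul, Complex.norm_I, mul_one, Complex.norm_real,
    Complex.norm_natCast, Real.norm_eq_abs]
  have := norm_limitMoment_le hd hfm hsupp hC hγ hG k
  have hS : 0 ≤ S := (abs_nonneg s).trans hs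
  gcongr

lemma continuousAt_limitCharFun {γ : ℝ} (hγ : 0 < γ) : ContinuousAt (limitCharFun f γ) 0 := by
  have hC0 : 0 ≤ C := (norm_nonneg _).trans (hC 0)
  refine tendsto_tsum_of_dominated_convergence
    (summable_momentBound hC0 (by linarith : 0 ≤ γ + 1) zero_le_one) (fun k => ?_) ?_
  · exact (Continuous.tendsto (by fun_prop) _)
  · filter_upwards [Metric.ball_mem_nhds (0 : ℝ) one_pos] with s hs k
    rw [mem_ball_zero_iff, Real.norm_eq_abs] at hs
    exact norm_limitCharFun_term_le hd hfm hsupp hC hγ (lt_add_one γ) hs.le k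

lemma continuousOn_limitCharFun (s : ℝ) : ContinuousOn (fun γ => limitCharFun f γ s) (Set.Ioi 0) := by
  have hC0 : 0 ≤ C := (norm_nonneg _).trans (hC 0)
  intro γ hγ
  refine (tendsto_tsum_of_dominated_convergence (G := ℂ)
    (summable_momentBound hC0 (by linarith [Set.mem_Ioi.1 hγ] : 0 ≤ γ + 1) (abs_nonneg s))
    (fun k => ?_) ?_)
  · refine (Continuous.tendsto ?_ γ).mono_left nhdsWithin_le_nhds
    unfold limitMoment
    fun_prop
  · filter_upwards [self_mem_nhdsWithin, nhdsWithin_le_nhds (gt_mem_nhds (lt_add_one γ))]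
      with γ' h1 h2 k
    exact norm_limitCharFun_term_le hd hfm hsupp hC h1 h2 le_rfl k

/-- The characteristic functions of the mean spectral measures converge. -/
theorem tendsto_charFun_meanSpectralMeasure (hf : IsHermitianFun f) {δ : ℕ → ℝ} {γ : ℝ} (hγ : 0 < γ)
    (hpos : ∀ n, 0 < δ n) (hδ0 : Tendsto δ atTop (𝓝 0))
    (hδ : Tendsto (fun n : ℕ => (n : ℝ) * δ n ^ d) atTop (𝓝 γ)) (s : ℝ) :
    Tendsto (fun n => charFun (meanSpectralMeasure hf hfm (cubeLaw d (δ (n + 1))⁻¹) n) s) atTop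
      (𝓝 (limitCharFun f γ s)) := by
  have hC0 : 0 ≤ C := (norm_nonneg _).trans (hC 0)
  have hprob : ∀ n, IsProbabilityMeasure (cubeLaw d (δ n)⁻¹) := fun n =>
    isProbabilityMeasure_cubeLaw d (inv_pos.2 (hpos n))
  simp_rw [charFun_meanSpectralMeasure hf hfm _ hC]
  refine (tendsto_tsum_of_dominated_convergence (G := ℂ)
    (f := fun n k => ((s : ℂ) * Complex.I) ^ k / k.factorial *
      meanMoment f (cubeLaw d (δ n)⁻¹) n k)
    (summable_momentBound hC0 (by linarith : 0 ≤ γ + 1) (abs_nonneg s))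
    (fun k => (tendsto_meanMoment hd hfm hsupp hC hpos hδ0 hδ k).const_mul _) ?_).comp
      (tendsto_add_atTop_nat 1)
  filter_upwards [hδ.eventually (gt_mem_nhds (lt_add_one γ))] with n hn k
  rw [norm_mul, norm_div, norm_pow, norm_mul, Complex.norm_I, mul_one, Complex.norm_real,
    Complex.norm_natCast, Real.norm_eq_abs]
  have := norm_meanMoment_le hfm hsupp hC (cubeLaw d (δ n)⁻¹) (pow_nonneg (hpos n).le d)
    (cubeLaw_sub_mem_centredCube_le d (hpos n)) hn.le k
  gcongr

/-- For a bounded function there are limit laws with the prescribed characteristic functions. -/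
theorem exists_charFun_eq_limitCharFun (hf : IsHermitianFun f) :
    ∃ ν : ℝ → ProbabilityMeasure ℝ, ∀ γ, 0 < γ → ∀ s,
      charFun (ν γ : Measure ℝ) s = limitCharFun f γ s := by
  have h : ∀ γ : ℝ, ∃ ν : ProbabilityMeasure ℝ, 0 < γ → ∀ s,
      charFun (ν : Measure ℝ) s = limitCharFun f γ s := fun γ => by
    by_cases hγ : 0 < γ
    · obtain ⟨δ, hpos, hδ0, hδ⟩ := exists_scale hd hγ
      have hprob : ∀ n, IsProbabilityMeasure (cubeLaw d (δ n)⁻¹) := fun n =>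
        isProbabilityMeasure_cubeLaw d (inv_pos.2 (hpos n))
      obtain ⟨ν, hν⟩ := exists_charFun_eq_of_tendsto
        (μ := fun n => ⟨meanSpectralMeasure hf hfm (cubeLaw d (δ (n + 1))⁻¹) n, inferInstance⟩)
        (continuousAt_limitCharFun hd hfm hsupp hC hγ)
        (tendsto_charFun_meanSpectralMeasure hd hfm hsupp hC hf hγ hpos hδ0 hδ)
      exact ⟨ν, fun _ => hν⟩
    · exact ⟨⟨Measure.dirac 0, inferInstance⟩, fun h => absurd h hγ⟩
  choose ν hν using h
  exact ⟨ν, hν⟩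

variable {ν : ℝ → ProbabilityMeasure ℝ}
  (hν : ∀ γ, 0 < γ → ∀ s, charFun (ν γ : Measure ℝ) s = limitCharFun f γ s)
include hν

lemma tendsto_meanSpectralMeasure (hf : IsHermitianFun f) {δ : ℕ → ℝ} {γ : ℝ} (hγ : 0 < γ)
    (hpos : ∀ n, 0 < δ n) (hδ0 : Tendsto δ atTop (𝓝 0))
    (hδ : Tendsto (fun n : ℕ => (n : ℝ) * δ n ^ d) atTop (𝓝 γ)) {μ : ℕ → ProbabilityMeasure ℝ}
    (hμ : ∀ n, (μ n : Measure ℝ) = meanSpectralMeasure hf hfm (cubeLaw d (δ (n + 1))⁻¹) n) :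
    Tendsto μ atTop (𝓝 (ν γ)) := by
  refine ProbabilityMeasure.tendsto_of_tendsto_charFun fun s => ?_
  simp_rw [hμ, hν γ hγ]
  exact tendsto_charFun_meanSpectralMeasure hd hfm hsupp hC hf hγ hpos hδ0 hδ s

/-- Convergence in the mean for a bounded function, tested against ramps. -/
lemma tendsto_integral_spectralStat_ramp (hf : IsHermitianFun f) {δ : ℕ → ℝ} {γ : ℝ} (hγ : 0 < γ)
    (hpos : ∀ n, 0 < δ n) (hδ0 : Tendsto δ atTop (𝓝 0))
    (hδ : Tendsto (fun n : ℕ => (n : ℝ) * δ n ^ d) atTop (𝓝 γ)) {a b : ℝ} (hab : a ≤ b) :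
    Tendsto (fun n => ∫ x, spectralStat hf (ramp a b) x
      ∂(Measure.pi fun _ : Fin n => cubeLaw d (δ n)⁻¹)) atTop
      (𝓝 (∫ t, ramp a b t ∂(ν γ : Measure ℝ))) := by
  have hprob : ∀ n, IsProbabilityMeasure (cubeLaw d (δ n)⁻¹) := fun n =>
    isProbabilityMeasure_cubeLaw d (inv_pos.2 (hpos n))
  rw [← tendsto_add_atTop_iff_nat 1]
  have h := (continuous_integral_ramp hab).tendsto _ |>.comp
    (tendsto_meanSpectralMeasure hd hfm hsupp hC hν hf hγ hpos hδ0 hδ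
      (μ := fun n => ⟨meanSpectralMeasure hf hfm (cubeLaw d (δ (n + 1))⁻¹) n, inferInstance⟩)
      fun n => rfl)
  refine h.congr fun n => ?_
  exact integral_meanSpectralMeasure hf hfm _ hC n (continuous_ramp a b)

/-- The limit law has the limit moments. -/
theorem moments_of_charFun_eq_limitCharFun (hf : IsHermitianFun f) {γ : ℝ} (hγ : 0 < γ) (k : ℕ) :
    Integrable (fun t : ℝ => t ^ k) (ν γ : Measure ℝ) ∧
      ((∫ t, t ^ k ∂(ν γ : Measure ℝ) : ℝ) : ℂ) = limitMoment f γ k := by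
  obtain ⟨δ, hpos, hδ0, hδ⟩ := exists_scale hd hγ
  have hprob : ∀ n, IsProbabilityMeasure (cubeLaw d (δ n)⁻¹) := fun n =>
    isProbabilityMeasure_cubeLaw d (inv_pos.2 (hpos n))
  let μ : ℕ → ProbabilityMeasure ℝ := fun n =>
    ⟨meanSpectralMeasure hf hfm (cubeLaw d (δ (n + 1))⁻¹) n, inferInstance⟩
  have hlim : ∀ k, Tendsto (fun n => ((∫ t, t ^ k ∂(μ n : Measure ℝ) : ℝ) : ℂ)) atTop
      (𝓝 (limitMoment f γ k)) := fun k => by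
    have h := (tendsto_meanMoment hd hfm hsupp hC hpos hδ0 hδ k).comp (tendsto_add_atTop_nat 1)
    exact h.congr fun n => (integral_pow_meanSpectralMeasure hf hfm _ hC n k).symm
  have hre : ∀ k, Tendsto (fun n => ∫ t, t ^ k ∂(μ n : Measure ℝ)) atTop
      (𝓝 (limitMoment f γ k).re) := fun k => by
    have := (Complex.continuous_re.tendsto _).comp (hlim k)
    exact this.congr fun n => Complex.ofReal_re _
  obtain ⟨h1, h2⟩ := moments_of_tendsto
    (tendsto_meanSpectralMeasure hd hfm hsupp hC hν hf hγ hpos hδ0 hδ (μ := μ) fun n => rfl)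
    (Eventually.of_forall fun n k =>
      integrable_meanSpectralMeasure hf hfm _ hC n (continuous_pow k)) hre k
  refine ⟨h1, ?_⟩
  rw [h2]
  exact tendsto_nhds_unique ((Complex.continuous_ofReal.tendsto _).comp (hre k)) (hlim k)

/-- The limit law of a bounded function is weakly continuous in the density. -/
lemma tendsto_of_charFun_eq_limitCharFun {γ : ℝ} (hγ : 0 < γ) {g : ℕ → ℝ} (hg : ∀ n, 0 < g n)
    (hlim : Tendsto g atTop (𝓝 γ)) : Tendsto (fun n => ν (g n)) atTop (𝓝 (ν γ)) := by
  refine ProbabilityMeasure.tendsto_of_tendsto_charFun fun s => ?_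
  simp_rw [hν γ hγ, hν _ (hg _)]
  exact (continuousOn_limitCharFun hd hfm hsupp hC s γ hγ).tendsto.comp
    (tendsto_nhdsWithin_iff.2 ⟨hlim, Eventually.of_forall hg⟩)

end Bounded

/-! ### Stability of spectral statistics -/

section Stability

variable {d : ℕ} {f g : (Fin d → ℝ) → ℂ}

lemma abs_spectralStat_ramp_le (hf : IsHermitianFun f) {a b : ℝ} (hab : a ≤ b) {n : ℕ}
    (x : Fin n → Fin d → ℝ) : |spectralStat hf (ramp a b) x| ≤ b - a := by
  have h0 : 0 ≤ b - a := sub_nonneg.2 hab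
  rw [spectralStat, abs_of_nonneg (mul_nonneg (by positivity)
    (Finset.sum_nonneg fun i _ => ramp_nonneg _ _ _))]
  refine (mul_le_mul_of_nonneg_left (Finset.sum_le_card_nsmul _ _ (b - a)
    fun i _ => ramp_le hab _) (by positivity)).trans ?_
  rw [Finset.card_univ, Fintype.card_fin, nsmul_eq_mul, ← mul_assoc]
  exact mul_le_of_le_one_left h0 inv_mul_le_one

lemma integrable_spectralStat_ramp (hf : IsHermitianFun f) (hfm : Measurable f) {a b : ℝ}
    (hab : a ≤ b) {n : ℕ} (P : Measure (Fin n → Fin d → ℝ)) [IsFiniteMeasure P] :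
    Integrable (spectralStat hf (ramp a b)) P :=
  (integrable_const (b - a)).mono'
    (measurable_spectralStat hf hfm (continuous_ramp a b) n).aestronglyMeasurable
    (ae_of_all _ fun x => abs_spectralStat_ramp_le hf hab x)

/-- Moving one point changes one row and one column of the matrix, so it moves the spectral statistic
by at most `(b - a) / n`. -/
lemma abs_spectralStat_ramp_update_sub_le (hf : IsHermitianFun f) {a b : ℝ} (hab : a ≤ b) {n : ℕ}
    (x : Fin n → Fin d → ℝ) (i : Fin n) (y : Fin d → ℝ) :
    |spectralStat hf (ramp a b) (Function.update x i y) - spectralStat hf (ramp a b) x| ≤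
      (b - a) / n := by
  have h := abs_sum_ramp_eigenvalues_sub_le (euclideanMatrix_isHermitian hf (Function.update x i y))
    (euclideanMatrix_isHermitian hf x) {i} (fun j hj k hk => by
      rw [Finset.mem_singleton] at hj hk
      simp [euclideanMatrix, hj, hk]) hab
  rw [Finset.card_singleton, Nat.cast_one, mul_one] at h
  rw [spectralStat, spectralStat, ← mul_sub, abs_mul, abs_of_nonneg (by positivity), div_eq_inv_mul]
  gcongr

/-- If `f` and `g` agree off `B`, the spectral statistics differ by at most a multiple of the number
of points which have another point in relative position `B`. -/
lemma abs_spectralStat_ramp_sub_le (hf : IsHermitianFun f) (hg : IsHermitianFun g)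
    {B : Set (Fin d → ℝ)} (h : ∀ x, x ∉ B → f x = g x) {a b : ℝ} (hab : a ≤ b) {n : ℕ}
    (x : Fin n → Fin d → ℝ) :
    |spectralStat hf (ramp a b) x - spectralStat hg (ramp a b) x| ≤
      (n : ℝ)⁻¹ * ((b - a) * ∑ i, ∑ j, B.indicator 1 (x i - x j)) := by
  classical
  have h1 := abs_sum_ramp_eigenvalues_sub_le (euclideanMatrix_isHermitian hf x)
    (euclideanMatrix_isHermitian hg x) (Finset.univ.filter fun i => ∃ j, x i - x j ∈ B)
    (fun i hi j _ => h _ fun hB => hi (by simpa using ⟨j, hB⟩)) hab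
  have h0 : ∀ i j, 0 ≤ B.indicator (1 : (Fin d → ℝ) → ℝ) (x i - x j) := fun i j =>
    Set.indicator_nonneg (fun _ _ => zero_le_one) _
  have h2 : ((Finset.univ.filter fun i => ∃ j, x i - x j ∈ B).card : ℝ) ≤
      ∑ i, ∑ j, B.indicator 1 (x i - x j) := by
    rw [Finset.card_filter, Nat.cast_sum]
    refine Finset.sum_le_sum fun i _ => ?_
    split_ifs with hi
    · obtain ⟨j, hj⟩ := hi
      refine le_trans ?_ (Finset.single_le_sum (fun j _ => h0 i j) (Finset.mem_univ j))
      simp [hj]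
    · simpa using Finset.sum_nonneg fun j _ => h0 i j
  rw [spectralStat, spectralStat, ← mul_sub, abs_mul, abs_of_nonneg (by positivity)]
  refine mul_le_mul_of_nonneg_left (h1.trans ?_) (by positivity)
  exact mul_le_mul_of_nonneg_left h2 (sub_nonneg.2 hab)

/-- Two different points of the sample are in relative position `B` with probability at most `c`. -/
lemma pi_sub_mem_le {ι : Type*} [Fintype ι] [DecidableEq ι] (μ : Measure (Fin d → ℝ))
    [IsProbabilityMeasure μ] {B : Set (Fin d → ℝ)} (hB : MeasurableSet B) {c : ENNReal}
    (hc : ∀ x, μ {y | x - y ∈ B} ≤ c) {i j : ι} (hij : i ≠ j) :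
    Measure.pi (fun _ : ι => μ) {x | x i - x j ∈ B} ≤ c := by
  classical
  have hE : MeasurableSet {x : ι → Fin d → ℝ | x i - x j ∈ B} :=
    ((measurable_pi_apply i).sub (measurable_pi_apply j)) hB
  have h := lintegral_pi_mul_le μ j (G := fun _ => 1)
    (H := {x : ι → Fin d → ℝ | x i - x j ∈ B}.indicator 1) measurable_const
    (measurable_one.indicator hE) (fun _ _ => rfl) (c := c) fun x => by
      refine le_trans (le_of_eq ?_) (hc (x i))
      have h2 : MeasurableSet {y | x i - y ∈ B} := (measurable_const_sub (x i)) hB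
      rw [← lintegral_indicator_one h2]
      refine lintegral_congr fun y => ?_
      rw [Set.indicator_apply, Set.indicator_apply]
      simp only [Set.mem_ofPred_eq, Function.update_of_ne hij, Function.update_self, Pi.one_apply]
  simpa [lintegral_indicator_one hE] using h

/-- If `f` and `g` agree off `B ∌ 0`, and a point has relative position `B` to a given one with
probability at most `c`, then the expected spectral statistics differ by at most `(b - a) n c`. -/
lemma abs_integral_spectralStat_ramp_sub_le (hf : IsHermitianFun f) (hfm : Measurable f)
    (hg : IsHermitianFun g) (hgm : Measurable g) {B : Set (Fin d → ℝ)} (hB : MeasurableSet B)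
    (h0 : 0 ∉ B) (h : ∀ x, x ∉ B → f x = g x) (μ : Measure (Fin d → ℝ)) [IsProbabilityMeasure μ]
    {c : ℝ} (hc0 : 0 ≤ c) (hc : ∀ x, μ {y | x - y ∈ B} ≤ ENNReal.ofReal c) {a b : ℝ} (hab : a ≤ b)
    (n : ℕ) :
    |∫ x, spectralStat hf (ramp a b) x ∂(Measure.pi fun _ : Fin n => μ) -
      ∫ x, spectralStat hg (ramp a b) x ∂(Measure.pi fun _ : Fin n => μ)| ≤ (b - a) * (n * c) := by
  have hba : 0 ≤ b - a := sub_nonneg.2 hab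
  let E : Fin n → Fin n → Set (Fin n → Fin d → ℝ) := fun i j => {x | x i - x j ∈ B}
  have hE : ∀ i j, MeasurableSet (E i j) := fun i j =>
    ((measurable_pi_apply i).sub (measurable_pi_apply j)) hB
  have hint : ∀ i j, Integrable (fun x : Fin n → Fin d → ℝ =>
      B.indicator (1 : (Fin d → ℝ) → ℝ) (x i - x j)) (Measure.pi fun _ : Fin n => μ) := fun i j =>
    (integrable_const (1 : ℝ)).indicator (hE i j)
  have hle : ∀ i j, ∫ x, B.indicator (1 : (Fin d → ℝ) → ℝ) (x i - x j)
      ∂(Measure.pi fun _ : Fin n => μ) ≤ c := fun i j => by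
    have h1 : ∫ x, B.indicator (1 : (Fin d → ℝ) → ℝ) (x i - x j) ∂(Measure.pi fun _ : Fin n => μ) =
        (Measure.pi fun _ : Fin n => μ).real (E i j) := integral_indicator_one (hE i j)
    rw [h1]
    by_cases hij : i = j
    · have : E i j = ∅ := by ext x; simp [E, hij, h0]
      simpa [this] using hc0
    · exact ENNReal.toReal_le_of_le_ofReal hc0 (pi_sub_mem_le μ hB hc hij)
  rw [← integral_sub (integrable_spectralStat_ramp hf hfm hab _)
    (integrable_spectralStat_ramp hg hgm hab _)]
  calc _ ≤ ∫ x, |spectralStat hf (ramp a b) x - spectralStat hg (ramp a b) x|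
        ∂(Measure.pi fun _ : Fin n => μ) := abs_integral_le_integral_abs
    _ ≤ ∫ x, (n : ℝ)⁻¹ * ((b - a) * ∑ i, ∑ j, B.indicator 1 (x i - x j))
        ∂(Measure.pi fun _ : Fin n => μ) :=
      integral_mono ((integrable_spectralStat_ramp hf hfm hab _).sub
          (integrable_spectralStat_ramp hg hgm hab _)).abs
        (((integrable_finsetSum _ fun i _ => integrable_finsetSum _ fun j _ =>
          hint i j).const_mul _).const_mul _)
        fun x => abs_spectralStat_ramp_sub_le hf hg h hab x
    _ = (n : ℝ)⁻¹ * ((b - a) * ∑ i, ∑ j, ∫ x, B.indicator (1 : (Fin d → ℝ) → ℝ) (x i - x j)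
        ∂(Measure.pi fun _ : Fin n => μ)) := by
      rw [integral_const_mul, integral_const_mul,
        integral_finsetSum _ fun i _ => integrable_finsetSum _ fun j _ => hint i j]
      simp_rw [integral_finsetSum _ fun j _ => hint _ j]
    _ ≤ (n : ℝ)⁻¹ * ((b - a) * ∑ _i : Fin n, ∑ _j : Fin n, c) := by
      gcongr with i _ j _
      exact hle i j
    _ = (b - a) * (n * c) := by
      rcases eq_or_ne n 0 with rfl | hn
      · simp
      · have : (n : ℝ) ≠ 0 := by exact_mod_cast hn
        simp only [Finset.sum_const, Finset.card_univ, Fintype.card_fin, nsmul_eq_mul]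
        field_simp

end Stability

/-! ### Truncation -/

section Truncation

variable {d : ℕ} {f : (Fin d → ℝ) → ℂ}

/-- The set where `f` is larger than `‖f 0‖ + k`. The offset keeps the origin, hence the diagonal of
the Euclidean matrices, out of it. -/
def tailSet (f : (Fin d → ℝ) → ℂ) (k : ℕ) : Set (Fin d → ℝ) := {x | ‖f 0‖ + k < ‖f x‖}

/-- The function `f` cut off to zero on `tailSet f k`. -/
noncomputable def truncate (f : (Fin d → ℝ) → ℂ) (k : ℕ) : (Fin d → ℝ) → ℂ :=
  (tailSet f k)ᶜ.indicator f

lemma measurableSet_tailSet (hfm : Measurable f) (k : ℕ) : MeasurableSet (tailSet f k) :=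
  measurableSet_lt measurable_const hfm.norm

lemma zero_notMem_tailSet (f : (Fin d → ℝ) → ℂ) (k : ℕ) : 0 ∉ tailSet f k := by
  simp [tailSet]

lemma antitone_tailSet (f : (Fin d → ℝ) → ℂ) : Antitone (tailSet f) := fun k l hkl x hx => by
  have : (k : ℝ) ≤ l := by exact_mod_cast hkl
  simp only [tailSet, Set.mem_ofPred_eq] at hx ⊢
  linarith

lemma tailSet_subset (hsupp : Function.support f ⊆ centredCube d 1) (k : ℕ) :
    tailSet f k ⊆ centredCube d 1 := fun x hx => hsupp fun h0 => by
  have h : ‖f 0‖ + k < ‖f x‖ := hx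
  rw [h0, norm_zero] at h
  exact h.not_ge (by positivity)

lemma volume_tailSet_ne_top (hsupp : Function.support f ⊆ centredCube d 1) (k : ℕ) :
    volume (tailSet f k) ≠ ⊤ :=
  measure_ne_top_of_subset (tailSet_subset hsupp k) (by simp [volume_centredCube])

lemma tendsto_volume_tailSet (hfm : Measurable f) (hsupp : Function.support f ⊆ centredCube d 1) :
    Tendsto (fun k => volume.real (tailSet f k)) atTop (𝓝 0) := by
  have h := tendsto_measure_iInter_atTop (μ := volume)
    (fun k => (measurableSet_tailSet hfm k).nullMeasurableSet) (antitone_tailSet f)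
    ⟨0, volume_tailSet_ne_top hsupp 0⟩
  have h0 : ⋂ k, tailSet f k = ∅ := by
    refine Set.eq_empty_of_forall_notMem fun x hx => ?_
    obtain ⟨k, hk⟩ := exists_nat_ge ‖f x‖
    have h : ‖f 0‖ + k < ‖f x‖ := Set.mem_iInter.1 hx k
    linarith [norm_nonneg (f 0)]
  rw [h0, measure_empty] at h
  exact (ENNReal.tendsto_toReal ENNReal.zero_ne_top).comp h

lemma measurable_truncate (hfm : Measurable f) (k : ℕ) : Measurable (truncate f k) :=
  hfm.indicator (measurableSet_tailSet hfm k).compl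

lemma support_truncate_subset (hsupp : Function.support f ⊆ centredCube d 1) (k : ℕ) :
    Function.support (truncate f k) ⊆ centredCube d 1 := by
  rw [truncate, Set.support_indicator]
  exact Set.inter_subset_right.trans hsupp

lemma isHermitianFun_truncate (hf : IsHermitianFun f) (k : ℕ) :
    IsHermitianFun (truncate f k) := fun x => by
  have h : -x ∈ (tailSet f k)ᶜ ↔ x ∈ (tailSet f k)ᶜ := by
    simp only [tailSet, Set.mem_compl_iff, Set.mem_ofPred_eq, hf x, norm_star]
  by_cases hx : x ∈ (tailSet f k)ᶜ
  · rw [truncate, Set.indicator_of_mem hx, Set.indicator_of_mem (h.2 hx), hf]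
  · rw [truncate, Set.indicator_of_notMem hx, Set.indicator_of_notMem (mt h.1 hx), star_zero]

lemma norm_truncate_le (f : (Fin d → ℝ) → ℂ) (k : ℕ) (x : Fin d → ℝ) :
    ‖truncate f k x‖ ≤ ‖f 0‖ + k := by
  by_cases hx : x ∈ (tailSet f k)ᶜ
  · rw [truncate, Set.indicator_of_mem hx]
    exact not_lt.1 hx
  · rw [truncate, Set.indicator_of_notMem hx, norm_zero]
    positivity

lemma truncate_of_notMem {k l : ℕ} (hkl : k ≤ l) {x : Fin d → ℝ} (hx : x ∉ tailSet f k) :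
    truncate f l x = f x :=
  Set.indicator_of_mem (s := (tailSet f l)ᶜ) (fun h => hx (antitone_tailSet f hkl h)) f

end Truncation

/-! ### The limit law for unbounded functions -/

/-- Interchange of limits: `u` converges to `l` if it is approximated by convergent sequences with
errors that become small. -/
lemma tendsto_of_approx {u : ℕ → ℝ} {l : ℝ} {w e : ℕ → ℕ → ℝ} {m E : ℕ → ℝ}
    (hw : ∀ k, Tendsto (w k) atTop (𝓝 (m k))) (hu : ∀ k n, |u n - w k n| ≤ e k n)
    (he : ∀ k, Tendsto (e k) atTop (𝓝 (E k))) (hl : ∀ k, |l - m k| ≤ E k)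
    (hE : Tendsto E atTop (𝓝 0)) : Tendsto u atTop (𝓝 l) := by
  rw [Metric.tendsto_atTop']
  intro ε hε
  obtain ⟨k, hk⟩ := (hE.eventually (gt_mem_nhds (by linarith : 0 < ε / 4))).exists
  have h1 := (he k).eventually (gt_mem_nhds hk)
  have h2 := (hw k).eventually (Metric.ball_mem_nhds _ (by linarith : 0 < ε / 4))
  obtain ⟨N, hN⟩ := eventually_atTop.1 (h1.and h2)
  refine ⟨N, fun n hn => ?_⟩
  obtain ⟨h3, h4⟩ := hN n hn.le
  rw [Real.dist_eq] at h4 ⊢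
  have h5 := abs_lt.1 h4
  have h6 := abs_le.1 (hu k n)
  have h7 := abs_le.1 (hl k)
  rw [abs_lt]
  constructor <;> linarith

section Unbounded

variable {d : ℕ} {f : (Fin d → ℝ) → ℂ}

lemma cubeLaw_sub_mem_tailSet_le (hfm : Measurable f)
    (hsupp : Function.support f ⊆ centredCube d 1) {δ : ℝ} (hδ : 0 < δ) (k : ℕ) (x : Fin d → ℝ) :
    cubeLaw d δ⁻¹ {y | x - y ∈ tailSet f k} ≤
      ENNReal.ofReal (δ ^ d * volume.real (tailSet f k)) := by
  refine (cubeLaw_sub_mem_le d (inv_pos.2 hδ) (measurableSet_tailSet hfm k) x).trans_eq ?_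
  rw [inv_inv, ENNReal.ofReal_mul (by positivity), ofReal_measureReal
    (volume_tailSet_ne_top hsupp k)]

/-- There are laws `ν γ`, weakly continuous in `γ`, to which the mean spectral measures converge at
density `γ`. -/
theorem exists_limitLaw (hd : 1 ≤ d) (hfm : Measurable f)
    (hsupp : Function.support f ⊆ centredCube d 1) (hf : IsHermitianFun f) :
    ∃ ν : ℝ → ProbabilityMeasure ℝ, ContinuousOn ν (Set.Ioi 0) ∧
      ∀ γ, 0 < γ → ∀ δ : ℕ → ℝ, (∀ n, 0 < δ n) → Tendsto δ atTop (𝓝 0) →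
        Tendsto (fun n : ℕ => (n : ℝ) * δ n ^ d) atTop (𝓝 γ) → ∀ a b : ℝ, a < b →
        Tendsto (fun n => ∫ x, spectralStat hf (ramp a b) x
          ∂(Measure.pi fun _ : Fin n => cubeLaw d (δ n)⁻¹)) atTop
          (𝓝 (∫ t, ramp a b t ∂(ν γ : Measure ℝ))) := by
  have hk := fun k => exists_charFun_eq_limitCharFun hd (measurable_truncate hfm k)
    (support_truncate_subset hsupp k) (norm_truncate_le f k) (isHermitianFun_truncate hf k)
  choose N hN using hk
  have hlim := fun k => fun (γ : ℝ) (hγ : 0 < γ) (δ : ℕ → ℝ) (hpos : ∀ n, 0 < δ n)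
    (hδ0 : Tendsto δ atTop (𝓝 0)) (hδ : Tendsto (fun n : ℕ => (n : ℝ) * δ n ^ d) atTop (𝓝 γ))
    (a b : ℝ) (hab : a < b) => tendsto_integral_spectralStat_ramp hd (measurable_truncate hfm k)
    (support_truncate_subset hsupp k) (norm_truncate_le f k) (hN k)
    (isHermitianFun_truncate hf k) hγ hpos hδ0 hδ hab.le
  -- The expected number of pairs of points in relative position `tailSet f k`, per point.
  let v : ℕ → ℝ := fun k => volume.real (tailSet f k)
  have herr : ∀ {γ : ℝ} {δ : ℕ → ℝ}, Tendsto (fun n : ℕ => (n : ℝ) * δ n ^ d) atTop (𝓝 γ) →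
      ∀ (a b : ℝ) (k : ℕ),
      Tendsto (fun n : ℕ => (b - a) * (n * (δ n ^ d * v k))) atTop (𝓝 ((b - a) * (γ * v k))) :=
    fun hδ a b k => by
      simpa only [mul_assoc] using (hδ.mul_const (v k)).const_mul (b - a)
  have hv0 : ∀ γ a b : ℝ, Tendsto (fun k => (b - a) * (γ * v k)) atTop (𝓝 0) := fun γ a b => by
    simpa using ((tendsto_volume_tailSet hfm hsupp).const_mul γ).const_mul (b - a)
  have hcauchy : ∀ γ, 0 < γ → ∀ a b : ℝ, a < b → ∀ K L, K ≤ L →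
      |∫ x, ramp a b x ∂(N L γ : Measure ℝ) - ∫ x, ramp a b x ∂(N K γ : Measure ℝ)| ≤
        (b - a) * (γ * v K) := fun γ hγ a b hab K L hKL => by
    obtain ⟨δ, hpos, hδ0, hδ⟩ := exists_scale hd hγ
    have hprob : ∀ n, IsProbabilityMeasure (cubeLaw d (δ n)⁻¹) := fun n =>
      isProbabilityMeasure_cubeLaw d (inv_pos.2 (hpos n))
    refine le_of_tendsto_of_tendsto' ((hlim L γ hγ δ hpos hδ0 hδ a b hab).sub
      (hlim K γ hγ δ hpos hδ0 hδ a b hab)).abs (herr hδ a b K) fun n => ?_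
    have := (hpos n).le
    exact abs_integral_spectralStat_ramp_sub_le _ (measurable_truncate hfm L) _
      (measurable_truncate hfm K) (measurableSet_tailSet hfm K) (zero_notMem_tailSet f K)
      (fun x hx => (truncate_of_notMem hKL hx).trans (truncate_of_notMem le_rfl hx).symm) _
      (by positivity) (cubeLaw_sub_mem_tailSet_le hfm hsupp (hpos n) K) hab.le n
  have hex : ∀ γ : ℝ, ∃ ν : ProbabilityMeasure ℝ, 0 < γ → Tendsto (fun k => N k γ) atTop (𝓝 ν) :=
    fun γ => by
      by_cases hγ : 0 < γ
      · obtain ⟨ν, hν⟩ := exists_tendsto_of_cauchy_ramp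
          (by simpa using (tendsto_volume_tailSet hfm hsupp).const_mul γ) (hcauchy γ hγ)
        exact ⟨ν, fun _ => hν⟩
      · exact ⟨⟨Measure.dirac 0, inferInstance⟩, fun h => absurd h hγ⟩
  choose ν hν using hex
  have happrox : ∀ γ, 0 < γ → ∀ a b : ℝ, a < b → ∀ K,
      |∫ x, ramp a b x ∂(ν γ : Measure ℝ) - ∫ x, ramp a b x ∂(N K γ : Measure ℝ)| ≤
        (b - a) * (γ * v K) := fun γ hγ a b hab K => by
    have h := ((continuous_integral_ramp hab.le).tendsto _).comp (hν γ hγ)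
    refine le_of_tendsto (h.sub_const _).abs ?_
    filter_upwards [eventually_ge_atTop K] with L hL using hcauchy γ hγ a b hab K L hL
  refine ⟨ν, fun γ hγ => ?_, fun γ hγ δ hpos hδ0 hδ a b hab => ?_⟩
  · refine tendsto_of_seq_tendsto fun g hg => ?_
    obtain ⟨hg1, hg2⟩ := tendsto_nhdsWithin_iff.1 hg
    -- The tail of the sequence is replaced by `γ`, to have positive densities throughout.
    let g' : ℕ → ℝ := fun n => if 0 < g n then g n else γ
    have hgg' : g' =ᶠ[atTop] g := hg2.mono fun n hn => if_pos hn
    have hg'0 : ∀ n, 0 < g' n := fun n => by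
      simp only [g']
      split_ifs with h
      exacts [h, hγ]
    have hg' : Tendsto g' atTop (𝓝 γ) := hg1.congr' hgg'.symm
    refine Tendsto.congr' (hgg'.mono fun n hn => congrArg ν hn) ?_
    refine tendsto_of_tendsto_ramp fun a b hab => ?_
    have hab' : (a : ℝ) < b := by exact_mod_cast hab
    exact tendsto_of_approx
      (fun k => ((continuous_integral_ramp hab'.le).tendsto _).comp
        (tendsto_of_charFun_eq_limitCharFun hd (measurable_truncate hfm k)
          (support_truncate_subset hsupp k) (norm_truncate_le f k) (hN k) hγ hg'0 hg'))
      (fun k n => happrox _ (hg'0 n) a b hab' k)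
      (fun k => (hg'.mul_const (v k)).const_mul ((b : ℝ) - a))
      (fun k => happrox γ hγ a b hab' k) (hv0 γ a b)
  · have hprob : ∀ n, IsProbabilityMeasure (cubeLaw d (δ n)⁻¹) := fun n =>
      isProbabilityMeasure_cubeLaw d (inv_pos.2 (hpos n))
    refine tendsto_of_approx (fun k => hlim k γ hγ δ hpos hδ0 hδ a b hab) (fun k n => ?_)
      (fun k => herr hδ a b k) (fun k => happrox γ hγ a b hab k) (hv0 γ a b)
    have := (hpos n).le
    exact abs_integral_spectralStat_ramp_sub_le hf hfm _ (measurable_truncate hfm k)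
      (measurableSet_tailSet hfm k) (zero_notMem_tailSet f k)
      (fun x hx => (truncate_of_notMem le_rfl hx).symm) _ (by positivity)
      (cubeLaw_sub_mem_tailSet_le hfm hsupp (hpos n) k) hab.le n

/-- Convergence of the expected spectral statistics improves to almost sure convergence of the
empirical spectral measures, by concentration. -/
theorem ae_tendsto_empiricalSpectralMeasure (hfm : Measurable f) (hf : IsHermitianFun f)
    {ν : ProbabilityMeasure ℝ} {δ : ℕ → ℝ} (hpos : ∀ n, 0 < δ n)
    (hlim : ∀ a b : ℝ, a < b → Tendsto (fun n => ∫ x, spectralStat hf (ramp a b) x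
      ∂(Measure.pi fun _ : Fin n => cubeLaw d (δ n)⁻¹)) atTop
      (𝓝 (∫ t, ramp a b t ∂(ν : Measure ℝ))))
    {S : Type*} [MeasurableSpace S] {P : Measure S} [IsProbabilityMeasure P]
    {X : (n : ℕ) → Fin n → S → (Fin d → ℝ)} (hX : ∀ n i, Measurable (X n i))
    (hind : ∀ n, iIndepFun (X n) P)
    (hunif : ∀ n i, pdf.IsUniform (X n i) (centredCube d (δ n)⁻¹) P) :
    ∀ᵐ ω ∂P, Tendsto
      (fun n : ℕ => empiricalSpectralMeasure (euclideanMatrix_isHermitian hf fun i => X n i ω))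
      atTop (𝓝 ν.toFiniteMeasure) := by
  have hprob : ∀ n, IsProbabilityMeasure (cubeLaw d (δ n)⁻¹) := fun n =>
    isProbabilityMeasure_cubeLaw d (inv_pos.2 (hpos n))
  have hae : ∀ᵐ ω ∂P, ∀ a b : ℚ, a < b → Tendsto (fun n : ℕ =>
      spectralStat hf (ramp a b) (fun i => X n i ω)) atTop
      (𝓝 (∫ t, ramp a b t ∂(ν : Measure ℝ))) := by
    refine ae_all_iff.2 fun a => ae_all_iff.2 fun b => ?_
    by_cases hab : a < b
    · have hab' : (a : ℝ) < b := by exact_mod_cast hab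
      have h := ae_tendsto_sub_mean_of_bounded_differences (fun n => cubeLaw d (δ n)⁻¹) hX hind
        (fun n i => hunif n i) (F := fun n => spectralStat hf (ramp a b))
        (fun n => measurable_spectralStat hf hfm (continuous_ramp _ _) n)
        (fun n x => abs_spectralStat_ramp_le hf hab'.le x)
        (K := Real.toNNReal ((b : ℝ) - a)) (by simpa using hab')
        (fun n x i y => by
          rw [Real.coe_toNNReal _ (sub_nonneg.2 hab'.le)]
          exact abs_spectralStat_ramp_update_sub_le hf hab'.le x i y)
      filter_upwards [h] with ω hω _
      simpa using hω.add (hlim a b hab')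
    · exact ae_of_all _ fun ω h => absurd h hab
  filter_upwards [hae] with ω hω
  rw [← tendsto_add_atTop_iff_nat 1]
  let μ : ℕ → ProbabilityMeasure ℝ := fun n => ⟨empiricalSpectralMeasure
      (euclideanMatrix_isHermitian hf fun i => X (n + 1) i ω),
      isProbabilityMeasure_empiricalSpectralMeasure n.succ_ne_zero _⟩
  have hfin : Tendsto μ atTop (𝓝 ν) := by
    refine tendsto_of_tendsto_ramp fun a b hab => ?_
    refine ((hω a b hab).comp (tendsto_add_atTop_nat 1)).congr fun n => ?_
    exact (integral_eq_spectralStat hf _ _).symm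
  exact (ProbabilityMeasure.tendsto_nhds_iff_toFiniteMeasure_tendsto_nhds _).1 hfin

end Unbounded

theorem theorem2 {d : ℕ} (hd : 1 ≤ d) (f : (Fin d → ℝ) → ℂ) (hf_meas : Measurable f)
    (hf_supp : Function.support f ⊆ centredCube d 1) (hf : IsHermitianFun f) :
    ∃ ν : ℝ → ProbabilityMeasure ℝ,
      -- almost sure weak convergence of the empirical eigenvalue distributions
      (∀ γ : ℝ, 0 < γ →
        ∀ δ : ℕ → ℝ, (∀ n, 0 < δ n) → Tendsto δ atTop (𝓝 0) →
          Tendsto (fun n : ℕ => (n : ℝ) * δ n ^ d) atTop (𝓝 γ) →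
        ∀ (S : Type*) [MeasurableSpace S] (P : Measure S) [IsProbabilityMeasure P]
          (X : (n : ℕ) → Fin n → S → (Fin d → ℝ)),
          (∀ n i, Measurable (X n i)) →
          (∀ n, iIndepFun (X n) P) →
          (∀ n i, pdf.IsUniform (X n i) (centredCube d (δ n)⁻¹) P) →
          ∀ᵐ ω ∂P, Tendsto
            (fun n : ℕ =>
              empiricalSpectralMeasure (euclideanMatrix_isHermitian hf fun i => X n i ω))
            atTop (𝓝 (ν γ).toFiniteMeasure)) ∧
      -- weak continuity of the limit in the density
      ContinuousOn ν (Set.Ioi 0) ∧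
      -- the moments of the limit
      ((∃ C : ℝ, ∀ x, ‖f x‖ ≤ C) →
        (∀ (m q : ℕ) (φ : Fin m → Fin (q + 1)), Function.Surjective φ →
          Integrable (cycleProduct f φ)) ∧
        ∀ γ : ℝ, 0 < γ → ∀ m : ℕ,
          Integrable (fun t : ℝ => t ^ m) (ν γ : Measure ℝ) ∧
          ((∫ t, t ^ m ∂(ν γ : Measure ℝ) : ℝ) : ℂ) = limitMoment f γ m) := by
  obtain ⟨ν, hcont, hlim⟩ := exists_limitLaw hd hf_meas hf_supp hf
  refine ⟨ν, fun γ hγ δ hpos hδ0 hδ S _ P _ X hX hind hunif =>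
    ae_tendsto_empiricalSpectralMeasure hf_meas hf hpos (hlim γ hγ δ hpos hδ0 hδ) hX hind hunif,
    hcont, fun ⟨C, hC⟩ => ⟨fun m q φ hφ => integrable_cycleProduct hf_meas hf_supp hC hφ,
      fun γ hγ m => ?_⟩⟩
  obtain ⟨ν', hν'⟩ := exists_charFun_eq_limitCharFun hd hf_meas hf_supp hC hf
  obtain ⟨δ, hpos, hδ0, hδ⟩ := exists_scale hd hγ
  -- Both measures are the limit of the mean spectral measures.
  have heq : (ν γ : Measure ℝ) = ν' γ := ext_of_integral_ramp fun a b hab =>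
    have hab' : (a : ℝ) < b := by exact_mod_cast hab
    tendsto_nhds_unique (hlim γ hγ δ hpos hδ0 hδ a b hab')
      (tendsto_integral_spectralStat_ramp hd hf_meas hf_supp hC hν' hf hγ hpos hδ0 hδ hab'.le)
  rw [heq]
  exact moments_of_charFun_eq_limitCharFun hd hf_meas hf_supp hC hν' hf hγ m
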